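/- Call a simple pentagon in the Euclidean plane (not assumed convex; interior angles equal to $180^\circ$ are allowed) *efficient* if it encloses area $1$ and its perimeter is at most $2\sqrt{2+\sqrt{3}}\approx 3.8637$, the perimeter of a unit-area Cairo pentagon (a pentagon circumscribed about a circle with three angles of $120^\circ$ and two non-adjacent right angles). Then every interior angle $a$ of an efficient pentagon satisfies $$80.91^\circ < a < 142.29^\circ .$$ -/

import Mathlib

open scoped Real Topology

namespace Polygon

/-- A polygon in the Euclidean plane is simple if consecutive vertices are distinct, two
consecutive edges meet only at their common vertex, and any two other distinct edges are
disjoint. Angles equal to `π` are allowed. (Meaningful for `n ≥ 3`.) -/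
def IsSimple {n : ℕ} (p : Polygon (EuclideanSpace ℝ (Fin 2)) n) : Prop :=
  p.HasNondegenerateEdges ∧
  (∀ i, p.edgeSet ℝ i ∩ p.edgeSet ℝ (finRotate n i) = {p (finRotate n i)}) ∧
  (∀ i j, i ≠ j → j ≠ finRotate n i → i ≠ finRotate n j →
    Disjoint (p.edgeSet ℝ i) (p.edgeSet ℝ j))

/-- The perimeter of a polygon: the sum of the lengths of its edges. -/
noncomputable def perimeter {n : ℕ} (p : Polygon (EuclideanSpace ℝ (Fin 2)) n) : ℝ :=
  ∑ i, dist (p i) (p (finRotate n i))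

/-- The open region enclosed by a polygon: the union of the bounded connected components of
the complement of its boundary curve. -/
def enclosedRegion {n : ℕ} (p : Polygon (EuclideanSpace ℝ (Fin 2)) n) :
    Set (EuclideanSpace ℝ (Fin 2)) :=
  {x | x ∈ (p.boundary ℝ)ᶜ ∧ Bornology.IsBounded (connectedComponentIn (p.boundary ℝ)ᶜ x)}

/-- The area of a polygon: the Lebesgue measure of the region it encloses. -/
noncomputable def area {n : ℕ} (p : Polygon (EuclideanSpace ℝ (Fin 2)) n) : ENNReal :=
  MeasureTheory.volume p.enclosedRegion

open Classical in
/-- The interior angle, in radians and in `(0, 2π)`, of a simple polygon at its `i`-th vertex.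
Let `α ∈ (0, π]` be the unoriented angle between the two edges at the vertex. The open segment
from the vertex to the midpoint of the two neighbouring vertices runs inside the sector of
opening `α`. If its points close to the vertex are enclosed by the polygon, the interior angle
is `α`; otherwise it is the angle `2π - α` of the complementary sector. (For a straight angle,
`α = π`, both values are `π`.) -/
noncomputable def interiorAngle {n : ℕ} (p : Polygon (EuclideanSpace ℝ (Fin 2)) n)
    (i : Fin n) : ℝ :=
  if ∀ᶠ t : ℝ in 𝓝[>] 0,
      AffineMap.lineMap (p i) (midpoint ℝ (p ((finRotate n).symm i)) (p (finRotate n i))) t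
        ∈ p.enclosedRegion then
    EuclideanGeometry.angle (p ((finRotate n).symm i)) (p i) (p (finRotate n i))
  else
    2 * π - EuclideanGeometry.angle (p ((finRotate n).symm i)) (p i) (p (finRotate n i))

/-- An efficient pentagon: a simple pentagon, not assumed convex, of unit area whose perimeter is
at most `2 √(2 + √3)`, the perimeter of the unit-area Cairo pentagon. -/
structure IsEfficient (p : Polygon (EuclideanSpace ℝ (Fin 2)) 5) : Prop where
  isSimple : p.IsSimple
  area_eq_one : p.area = 1
  perimeter_le : p.perimeter ≤ 2 * √(2 + √3)

end Polygon

namespace Pentagon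

open MeasureTheory Set

/-! Convexity comes first. An efficient pentagon has perimeter below 4, the perimeter of the unit
square. If a vertex lay in the hull of the other four, skipping it would give a closed tour of four
points of length below 4, whose hull has area below 1 (`volume_convexHull_four_le`). So the vertices
are in convex position, and disjointness of non-adjacent edges makes their cyclic order convex
(`exists_strictlyConvex`).

For a convex pentagon with turning angles `τ i`, area `A` and perimeter `P`, Lhuilier's inequality
(`lhuilier`) says `P ^ 2 ≥ 4 * A * ∑ tan (τ i / 2)`: among polygons with given edge directions the
circumscribed one is best. Efficiency therefore gives `∑ tan (τ i / 2) ≤ 2 + √3`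
(`sum_tan_turn_le`).

The half turning angles add up to `π` and the tangent is convex, so a half angle too far from `π /
5` pushes this sum above `2 + √3`, even if the other four are equal (`le_sum_tan`). Explicit
arctangent estimates turn this into the stated degrees (`half_exterior_bounds`). -/

abbrev Plane := EuclideanSpace ℝ (Fin 2)

/-! ### Determinants, convex hulls and areas of triangles -/

/-- The cross product of two plane vectors. -/
def cross (v w : Plane) : ℝ := v 0 * w 1 - v 1 * w 0

/-- Twice the signed area of a triangle. -/
def det (a b c : Plane) : ℝ := cross (b - a) (c - a)

theorem det_eq (a b c : Plane) :
    det a b c = (b 0 - a 0) * (c 1 - a 1) - (b 1 - a 1) * (c 0 - a 0) := by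
  simp [det, cross]

theorem inner_eq (v w : Plane) : inner ℝ v w = v 0 * w 0 + v 1 * w 1 := by
  simp [PiLp.inner_apply, Fin.sum_univ_two, mul_comm]

theorem norm_sq_eq (v : Plane) : ‖v‖ ^ 2 = v 0 ^ 2 + v 1 ^ 2 := by
  simp [EuclideanSpace.norm_sq_eq, Fin.sum_univ_two]

theorem abs_cross_le (v w : Plane) : |cross v w| ≤ ‖v‖ * ‖w‖ := by
  apply abs_le_of_sq_le_sq _ (by positivity)
  rw [mul_pow, norm_sq_eq, norm_sq_eq, cross]
  nlinarith [sq_nonneg (v 0 * w 0 + v 1 * w 1)]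

theorem abs_det_le (a b c : Plane) : |det a b c| ≤ dist a b * dist a c := by
  rw [dist_comm a b, dist_comm a c, dist_eq_norm, dist_eq_norm]
  exact abs_cross_le _ _

theorem det_rotate (a b c : Plane) : det b c a = det a b c := by
  simp only [det_eq]; ring

theorem mem_convexHull_range {ι E : Type*} [Fintype ι] [AddCommGroup E] [Module ℝ E] {f : ι → E}
    {x : E} : x ∈ convexHull ℝ (range f) ↔
      ∃ w : ι → ℝ, (∀ i, 0 ≤ w i) ∧ ∑ i, w i = 1 ∧ ∑ i, w i • f i = x := by
  classical
  constructor
  · intro hx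
    refine convexHull_min (t := {x | ∃ w : ι → ℝ, (∀ i, 0 ≤ w i) ∧ ∑ i, w i = 1 ∧
      ∑ i, w i • f i = x}) ?_ ?_ hx
    · rintro _ ⟨i, rfl⟩
      refine ⟨Pi.single i 1, fun j => ?_, by simp, ?_⟩
      · by_cases h : j = i
        · subst h; simp
        · simp [h]
      · simp [Pi.single_apply]
    · rintro _ ⟨w, hw, hw1, rfl⟩ _ ⟨v, hv, hv1, rfl⟩ a b ha hb hab
      refine ⟨fun i => a * w i + b * v i, fun i => ?_, ?_, ?_⟩
      · have := hw i; have := hv i; positivity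
      · rw [Finset.sum_add_distrib, ← Finset.mul_sum, ← Finset.mul_sum, hw1, hv1]; simpa using hab
      · simp only [add_smul, Finset.sum_add_distrib, Finset.smul_sum, mul_smul]
  · rintro ⟨w, hw, hw1, rfl⟩
    exact (convex_convexHull ℝ _).sum_mem (fun i _ => hw i) hw1
      (fun i _ => subset_convexHull ℝ _ (mem_range_self i))

theorem mem_triangle_of_weights {E : Type*} [AddCommGroup E] [Module ℝ E] {a b c x : E}
    {α β γ : ℝ} (hα : 0 ≤ α) (hβ : 0 ≤ β) (hγ : 0 ≤ γ) (h : α + β + γ = 1)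
    (hx : α • a + β • b + γ • c = x) : x ∈ convexHull ℝ {a, b, c} := by
  have hr : range ![a, b, c] = {a, b, c} := by
    simp only [Matrix.range_cons, Matrix.range_empty, union_empty, singleton_union]
  rw [← hr]
  refine mem_convexHull_range.2 ⟨![α, β, γ], fun i => ?_, ?_, ?_⟩
  · fin_cases i <;> simpa
  · simpa [Fin.sum_univ_three] using h
  · simpa [Fin.sum_univ_three] using hx

theorem volume_standard_triangle :
    volume {x : Plane | 0 ≤ x 0 ∧ 0 ≤ x 1 ∧ x 0 + x 1 ≤ 1} ≤ ENNReal.ofReal (1 / 2) := by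
  let S : Set (ℝ × ℝ) := {x | 0 ≤ x.1 ∧ 0 ≤ x.2 ∧ x.1 + x.2 ≤ 1}
  have hS : MeasurableSet S := by
    apply IsClosed.measurableSet
    apply IsClosed.inter (isClosed_le continuous_const continuous_fst)
    apply IsClosed.inter (isClosed_le continuous_const continuous_snd)
    exact isClosed_le (continuous_fst.add continuous_snd) continuous_const
  have h1 : {x : Plane | 0 ≤ x 0 ∧ 0 ≤ x 1 ∧ x 0 + x 1 ≤ 1} =
      (fun x : Plane => (MeasurableEquiv.finTwoArrow (WithLp.ofLp x))) ⁻¹' S := by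
    ext x; simp [S]
  have hm : MeasurePreserving (fun x : Plane => (MeasurableEquiv.finTwoArrow (WithLp.ofLp x))) :=
    (volume_preserving_finTwoArrow ℝ).comp (PiLp.volume_preserving_ofLp (Fin 2))
  rw [h1, hm.measure_preimage hS.nullMeasurableSet, Measure.volume_eq_prod,
    Measure.prod_apply hS]
  have h2 : ∀ x : ℝ, volume (Prod.mk x ⁻¹' S) ≤
      (Icc (0 : ℝ) 1).indicator (fun x => ENNReal.ofReal (1 - x)) x := by
    intro x
    by_cases hx : x ∈ Icc (0 : ℝ) 1
    · rw [indicator_of_mem hx]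
      calc _ ≤ volume (Icc 0 (1 - x)) := by
            apply measure_mono
            rintro y ⟨_, h0, h1⟩
            simp only at h0 h1
            exact ⟨h0, by linarith⟩
        _ = _ := by simp
    · rw [indicator_of_notMem hx]
      have : Prod.mk x ⁻¹' S = ∅ := by
        ext y
        simp only [mem_preimage, mem_empty_iff_false, iff_false]
        rintro ⟨h, h0, h1⟩
        simp only at h h0 h1
        exact hx ⟨h, by linarith⟩
      simp [this]
  refine (lintegral_mono h2).trans ?_
  rw [lintegral_indicator measurableSet_Icc, ← ofReal_integral_eq_lintegral_ofReal]
  · apply ENNReal.ofReal_le_ofReal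
    rw [integral_Icc_eq_integral_Ioc, ← intervalIntegral.integral_of_le zero_le_one]
    rw [intervalIntegral.integral_sub (by simp) (by simp)]
    simp
    norm_num
  · exact (Continuous.integrableOn_Icc (by fun_prop))
  · exact (ae_restrict_mem measurableSet_Icc).mono fun x hx => by simpa using hx.2

theorem volume_triangle_le (a b c : Plane) :
    volume (convexHull ℝ {a, b, c}) ≤ ENNReal.ofReal (|det a b c| / 2) := by
  let M : Matrix (Fin 2) (Fin 2) ℝ := !![b 0 - a 0, c 0 - a 0; b 1 - a 1, c 1 - a 1]
  let L : Plane →ₗ[ℝ] Plane := Matrix.toLpLin 2 2 M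
  have hL : LinearMap.det L = det a b c := by
    have : LinearMap.det L = M.det :=
      (LinearMap.det_conj (Matrix.toLin' M) (WithLp.linearEquiv 2 ℝ _).symm).trans
        (LinearMap.det_toLin' M)
    rw [this, det_eq, Matrix.det_fin_two]
    simp [M]; ring
  have hsub : convexHull ℝ {a, b, c} ⊆
      (fun x => a + x) '' (L '' {x : Plane | 0 ≤ x 0 ∧ 0 ≤ x 1 ∧ x 0 + x 1 ≤ 1}) := by
    have hr : range ![a, b, c] = {a, b, c} := by
      simp only [Matrix.range_cons, Matrix.range_empty, union_empty, singleton_union]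
    rw [← hr]
    intro x hx
    obtain ⟨w, hw, hw1, rfl⟩ := mem_convexHull_range.1 hx
    simp only [Fin.sum_univ_three] at hw1
    refine ⟨_, ⟨!₂[w 1, w 2], ⟨hw 1, hw 2, ?_⟩, rfl⟩, ?_⟩
    · have := hw 0; simp; linarith
    · have h0 : w 0 = 1 - w 1 - w 2 := by linarith
      ext i
      fin_cases i <;>
      simp [L, M, Matrix.toLpLin_apply, Fin.sum_univ_three, h0] <;> ring
  refine (measure_mono hsub).trans ?_
  rw [image_add_left, measure_preimage_add, Measure.addHaar_image_linearMap, hL]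
  refine (mul_le_mul_right volume_standard_triangle _).trans ?_
  rw [← ENNReal.ofReal_mul (abs_nonneg _)]
  exact le_of_eq (by ring_nf)

/-! ### The isoperimetric inequality for four points -/

/-- If the points `f i` are affinely dependent through `l`, then a convex combination of them can
dispense with one of the points of positive coefficient in `l`. -/
theorem exists_mem_convexHull_compl {ι E : Type*} [Fintype ι] [AddCommGroup E] [Module ℝ E]
    {f : ι → E} {l : ι → ℝ} (hl : ∑ i, l i = 0) (hlf : ∑ i, l i • f i = 0)
    (hpos : ∃ i, 0 < l i) {x : E} (hx : x ∈ convexHull ℝ (range f)) :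
    ∃ j, 0 < l j ∧ x ∈ convexHull ℝ (f '' {j}ᶜ) := by
  classical
  obtain ⟨w, hw, hw1, rfl⟩ := mem_convexHull_range.1 hx
  obtain ⟨i₀, hi₀⟩ := hpos
  obtain ⟨j, hj, hmin⟩ := Finset.exists_min_image (Finset.univ.filter fun i => 0 < l i)
    (fun i => w i / l i) ⟨i₀, by simpa using hi₀⟩
  have hj : 0 < l j := by simpa using hj
  refine ⟨j, hj, ?_⟩
  -- The largest multiple of `l` that can be subtracted from the weights while keeping them
  -- nonnegative; the weight at `j` becomes zero.
  let t := w j / l j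
  have ht : 0 ≤ t := div_nonneg (hw j) hj.le
  have hv : ∀ i, 0 ≤ w i - t * l i := by
    intro i
    rcases le_or_gt (l i) 0 with h | h
    · have := mul_nonneg ht (neg_nonneg.2 h)
      have := hw i
      linarith
    · have := hmin i (by simpa using h)
      have := (le_div_iff₀ h).1 this
      simp only [t]; linarith
  have hvj : w j - t * l j = 0 := by simp only [t]; field_simp; ring
  have hs : ∑ i, (w i - t * l i) = 1 := by
    rw [Finset.sum_sub_distrib, ← Finset.mul_sum, hl, hw1]; ring
  have he : ∑ i, w i • f i = ∑ i, (w i - t * l i) • f i := by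
    simp only [sub_smul, mul_smul, Finset.sum_sub_distrib, ← Finset.smul_sum, hlf]; simp
  rw [he, ← Finset.sum_erase_add _ _ (Finset.mem_univ j), hvj, zero_smul, add_zero]
  refine (convex_convexHull ℝ _).sum_mem (fun i _ => hv i) ?_ ?_
  · rw [← hs, ← Finset.sum_erase_add (Finset.univ) _ (Finset.mem_univ j), hvj, add_zero]
  · intro i hi
    exact subset_convexHull ℝ _ ⟨i, by simpa using hi, rfl⟩

theorem exists_affine_dependency (f : Fin 4 → Plane) :
    ∃ l : Fin 4 → ℝ, l ≠ 0 ∧ ∑ i, l i = 0 ∧ ∑ i, l i • f i = 0 := by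
  let φ : (Fin 4 → ℝ) →ₗ[ℝ] Plane × ℝ :=
    (Fintype.linearCombination ℝ f).prod (Fintype.linearCombination ℝ fun _ => (1 : ℝ))
  have h : LinearMap.ker φ ≠ ⊥ := by
    apply LinearMap.ker_ne_bot_of_finrank_lt
    simp
  obtain ⟨l, hl, hl0⟩ := Submodule.exists_mem_ne_zero_of_ne_bot h
  have := LinearMap.mem_ker.1 hl
  simp only [φ, LinearMap.prod_apply, Function.prod_apply, Prod.mk_eq_zero,
    Fintype.linearCombination_apply, smul_eq_mul, mul_one] at this
  exact ⟨l, hl0, this.2, this.1⟩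

/-- Every point of the convex hull of four points lies in two of the four triangles. -/
theorem exists_two_triangles {f : Fin 4 → Plane} {x : Plane} (hx : x ∈ convexHull ℝ (range f)) :
    ∃ i j, i ≠ j ∧ x ∈ convexHull ℝ (f '' {i}ᶜ) ∧ x ∈ convexHull ℝ (f '' {j}ᶜ) := by
  obtain ⟨l, hl0, hl, hlf⟩ := exists_affine_dependency f
  obtain ⟨i₀, hi₀⟩ := Function.ne_iff.1 hl0
  have hpos : ∃ i, 0 < l i := by
    by_contra! h
    exact hi₀ ((Finset.sum_eq_zero_iff_of_nonpos fun i _ => h i).1 hl i₀ (Finset.mem_univ _))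
  have hneg : ∃ i, 0 < (-l) i := by
    by_contra! h
    simp only [Pi.neg_apply, Left.neg_nonpos_iff] at h
    exact hi₀ ((Finset.sum_eq_zero_iff_of_nonneg fun i _ => h i).1 hl i₀ (Finset.mem_univ _))
  -- Applied to `l` and to `-l`, the reduction drops one index where `l` is positive and one where
  -- it is negative, hence two different ones.
  obtain ⟨i, hi, hxi⟩ := exists_mem_convexHull_compl hl hlf hpos hx
  obtain ⟨j, hj, hxj⟩ := exists_mem_convexHull_compl (l := -l) (by simp [hl]) (by simp [hlf])
    hneg hx
  refine ⟨i, j, ?_, hxi, hxj⟩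
  rintro rfl
  simp only [Pi.neg_apply] at hj
  linarith

theorem isCompact_convexHull_image {ι : Type*} [Finite ι] (f : ι → Plane) (s : Set ι) :
    IsCompact (convexHull ℝ (f '' s)) :=
  (s.toFinite.image f).isCompact_convexHull (𝕜 := ℝ)

/-- The four triangles cover the hull at least twice; integrate the sum of their indicators. -/
theorem two_mul_volume_convexHull_le (f : Fin 4 → Plane) :
    2 * volume (convexHull ℝ (range f)) ≤ ∑ i, volume (convexHull ℝ (f '' {i}ᶜ)) := by
  classical
  have hm : ∀ i, MeasurableSet (convexHull ℝ (f '' {i}ᶜ)) := fun i =>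
    (isCompact_convexHull_image f _).isClosed.measurableSet
  have hm' : MeasurableSet (convexHull ℝ (range f)) :=
    ((finite_range f).isCompact_convexHull (𝕜 := ℝ)).isClosed.measurableSet
  calc 2 * volume (convexHull ℝ (range f))
      = ∫⁻ x, (convexHull ℝ (range f)).indicator (fun _ => 2) x := by
        rw [lintegral_indicator hm']; simp
    _ ≤ ∫⁻ x, ∑ i, (convexHull ℝ (f '' {i}ᶜ)).indicator (fun _ => 1) x := by
        apply lintegral_mono
        intro x
        by_cases hx : x ∈ convexHull ℝ (range f)
        · obtain ⟨i, j, hij, hi, hj⟩ := exists_two_triangles hx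
          rw [indicator_of_mem hx]
          calc (2 : ENNReal) = ∑ k ∈ {i, j}, (convexHull ℝ (f '' {k}ᶜ)).indicator
                (fun _ => (1 : ENNReal)) x := by
                rw [Finset.sum_pair hij, indicator_of_mem hi, indicator_of_mem hj]; norm_num
            _ ≤ _ := Finset.sum_le_sum_of_subset (Finset.subset_univ _)
        · simp only [indicator_of_notMem hx]; exact zero_le
    _ = ∑ i, volume (convexHull ℝ (f '' {i}ᶜ)) := by
        rw [lintegral_finsetSum _ fun i _ => measurable_const.indicator (hm i)]
        exact Finset.sum_congr rfl fun i _ => by rw [lintegral_indicator (hm i)]; simp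

theorem volume_triangle_le_dist (a b c : Plane) :
    volume (convexHull ℝ {a, b, c}) ≤ ENNReal.ofReal (dist a b * dist a c / 2) :=
  (volume_triangle_le a b c).trans (ENNReal.ofReal_le_ofReal (by
    have := abs_det_le a b c; linarith))

/-- The isoperimetric inequality for four points, joined by a closed tour in any order. -/
theorem volume_convexHull_four_le (a b c d : Plane) :
    volume (convexHull ℝ {a, b, c, d}) ≤
      ENNReal.ofReal ((dist a b + dist b c + dist c d + dist d a) ^ 2 / 16) := by
  let f : Fin 4 → Plane := ![a, b, c, d]
  have hr : range f = {a, b, c, d} := by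
    simp only [f, Matrix.range_cons, Matrix.range_empty, union_empty, singleton_union]
  have h := two_mul_volume_convexHull_le f
  rw [hr, Fin.sum_univ_four] at h
  have t0 : volume (convexHull ℝ (f '' {0}ᶜ)) ≤ ENNReal.ofReal (dist b c * dist c d / 2) := by
    rw [dist_comm b c]
    refine le_trans (measure_mono (convexHull_mono ?_)) (volume_triangle_le_dist c b d)
    rintro _ ⟨i, hi, rfl⟩
    fin_cases i <;> simp_all [f]
  have t1 : volume (convexHull ℝ (f '' {1}ᶜ)) ≤ ENNReal.ofReal (dist c d * dist d a / 2) := by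
    rw [dist_comm c d]
    refine le_trans (measure_mono (convexHull_mono ?_)) (volume_triangle_le_dist d c a)
    rintro _ ⟨i, hi, rfl⟩
    fin_cases i <;> simp_all [f]
  have t2 : volume (convexHull ℝ (f '' {2}ᶜ)) ≤ ENNReal.ofReal (dist d a * dist a b / 2) := by
    rw [dist_comm d a]
    refine le_trans (measure_mono (convexHull_mono ?_)) (volume_triangle_le_dist a d b)
    rintro _ ⟨i, hi, rfl⟩
    fin_cases i <;> simp_all [f]
  have t3 : volume (convexHull ℝ (f '' {3}ᶜ)) ≤ ENNReal.ofReal (dist a b * dist b c / 2) := by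
    rw [dist_comm a b]
    refine le_trans (measure_mono (convexHull_mono ?_)) (volume_triangle_le_dist b a c)
    rintro _ ⟨i, hi, rfl⟩
    fin_cases i <;> simp_all [f]
  have h' := h.trans (add_le_add (add_le_add (add_le_add t0 t1) t2) t3)
  rw [← ENNReal.ofReal_add (by positivity) (by positivity),
    ← ENNReal.ofReal_add (by positivity) (by positivity),
    ← ENNReal.ofReal_add (by positivity) (by positivity)] at h'
  rw [← ENNReal.mul_le_mul_iff_right (a := 2) (by simp) (by simp)]
  refine h'.trans ?_
  have h2 : ∀ x : ℝ, 2 * ENNReal.ofReal x = ENNReal.ofReal (2 * x) := fun x => by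
    rw [ENNReal.ofReal_mul (by norm_num), ENNReal.ofReal_ofNat]
  rw [h2]
  apply ENNReal.ofReal_le_ofReal
  -- Each triangle was bounded by half the product of two consecutive sides of the tour. The four
  -- products add up to `(ab + cd) * (bc + da)`, at most the square of half the length.
  nlinarith [sq_nonneg ((dist a b + dist c d) - (dist b c + dist d a))]

/-! ### Orientations and strictly convex position -/

/-- The barycentric relation between four points of the plane. -/
theorem det_relation (a b c d : Plane) :
    det b c d • a + (-det a c d) • b + det a b d • c + (-det a b c) • d = 0 := by
  ext i
  fin_cases i <;> simp [det_eq] <;> ring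

theorem det_sum (a b c d : Plane) : det b c d - det a c d + det a b d - det a b c = 0 := by
  simp only [det_eq]; ring

theorem mem_triangle_of_relation {a b c d : Plane} {α β γ δ : ℝ} (hα : 0 ≤ α) (hβ : 0 ≤ β)
    (hγ : 0 ≤ γ) (hδ : δ < 0) (hs : α + β + γ + δ = 0)
    (h : α • a + β • b + γ • c + δ • d = 0) : d ∈ convexHull ℝ {a, b, c} := by
  have hδ' : 0 < -δ := by linarith
  refine mem_triangle_of_weights (div_nonneg hα hδ'.le) (div_nonneg hβ hδ'.le)
    (div_nonneg hγ hδ'.le) ?_ ?_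
  · rw [← add_div, ← add_div, div_eq_one_iff_eq hδ'.ne']; linarith
  · have h1 : α • a + β • b + γ • c = (-δ) • d := by linear_combination (norm := module) (1 : ℝ) • h
    have h2 : d = (-δ)⁻¹ • ((-δ) • d) := by rw [smul_smul, inv_mul_cancel₀ hδ'.ne', one_smul]
    rw [h2, ← h1]
    simp only [div_eq_inv_mul, smul_add, mul_smul]

theorem segments_meet_of_relation {a b c d : Plane} {α β γ δ : ℝ} (hα : 0 < α) (hβ : 0 < β)
    (hγ : γ < 0) (hδ : δ < 0) (hs : α + β + γ + δ = 0)
    (h : α • a + β • b + γ • c + δ • d = 0) : ¬Disjoint (segment ℝ a b) (segment ℝ c d) := by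
  rw [not_disjoint_iff]
  have hn : 0 < α + β := by linarith
  refine ⟨(α + β)⁻¹ • (α • a + β • b), ⟨(α + β)⁻¹ * α, (α + β)⁻¹ * β, by positivity,
    by positivity, by field_simp, by simp only [smul_add, mul_smul]⟩, ⟨(α + β)⁻¹ * (-γ),
    (α + β)⁻¹ * (-δ), mul_nonneg (by positivity) (by linarith),
    mul_nonneg (by positivity) (by linarith), by field_simp; linarith, ?_⟩⟩
  have h1 : α • a + β • b = (-γ) • c + (-δ) • d := by linear_combination (norm := module) (1 : ℝ) • h
  rw [h1, smul_add, mul_smul, mul_smul]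

theorem collinear_of_det_eq_zero {a b c : Plane} (h : det a b c = 0) :
    Collinear ℝ {a, b, c} := by
  by_cases hab : a = b
  · subst hab; simp [collinear_pair]
  rw [collinear_iff_of_mem (p₀ := a) (by simp)]
  refine ⟨b - a, ?_⟩
  have hn : 0 < (b 0 - a 0) ^ 2 + (b 1 - a 1) ^ 2 := by
    have := norm_sq_eq (b - a)
    simp only [PiLp.sub_apply] at this
    rw [← this]
    exact pow_pos (norm_pos_iff.2 (sub_ne_zero.2 (Ne.symm hab))) 2
  simp only [mem_insert_iff, mem_singleton_iff, forall_eq_or_imp, forall_eq, vadd_eq_add]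
  refine ⟨⟨0, by simp⟩, ⟨1, by simp⟩, ⟨((c 0 - a 0) * (b 0 - a 0) + (c 1 - a 1) * (b 1 - a 1)) /
    ((b 0 - a 0) ^ 2 + (b 1 - a 1) ^ 2), ?_⟩⟩
  rw [det_eq] at h
  ext i
  fin_cases i
  · simp only [Fin.zero_eta, PiLp.add_apply, PiLp.smul_apply, PiLp.sub_apply, smul_eq_mul]
    rw [div_mul_eq_mul_div, ← sub_eq_iff_eq_add, eq_div_iff hn.ne']
    linear_combination -(b 1 - a 1) * h
  · simp only [Fin.mk_one, PiLp.add_apply, PiLp.smul_apply, PiLp.sub_apply, smul_eq_mul]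
    rw [div_mul_eq_mul_div, ← sub_eq_iff_eq_add, eq_div_iff hn.ne']
    linear_combination (b 0 - a 0) * h

theorem notMem_convexHull_of_subset {s t : Set Plane} {x : Plane} (hx : x ∉ convexHull ℝ s)
    (h : t ⊆ s) : x ∉ convexHull ℝ t := fun h' => hx (convexHull_mono h h')

theorem det_ne_zero_of_notMem {a b c d : Plane} (ha : a ∉ convexHull ℝ {b, c, d})
    (hb : b ∉ convexHull ℝ {a, c, d}) (hc : c ∉ convexHull ℝ {a, b, d}) : det a b c ≠ 0 := by
  intro h
  rcases (collinear_of_det_eq_zero h).wbtw_or_wbtw_or_wbtw with h | h | h <;>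
    rw [← mem_segment_iff_wbtw] at h
  · exact hb (segment_subset_convexHull (by simp) (by simp) h)
  · exact hc (segment_subset_convexHull (by simp) (by simp) h)
  · exact ha (segment_subset_convexHull (by simp) (by simp) h)

/-- The orientations of four points in convex position such that the segments `ab` and
`cd` are disjoint. -/
theorem orientations_of_four {a b c d : Plane} (ha : a ∉ convexHull ℝ {b, c, d})
    (hb : b ∉ convexHull ℝ {a, c, d}) (hc : c ∉ convexHull ℝ {a, b, d})
    (hd : d ∉ convexHull ℝ {a, b, c}) (hdis : Disjoint (segment ℝ a b) (segment ℝ c d)) :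
    0 < det a b c * det a b d ∧ 0 < det a c d * det b c d := by
  have hx : det a b c ≠ 0 := det_ne_zero_of_notMem ha hb hc
  have hy : det a b d ≠ 0 := det_ne_zero_of_notMem (d := c)
    (notMem_convexHull_of_subset ha (by grind)) (notMem_convexHull_of_subset hb (by grind))
    (notMem_convexHull_of_subset hd (by grind))
  have hz : det a c d ≠ 0 := det_ne_zero_of_notMem (d := b)
    (notMem_convexHull_of_subset ha (by grind)) (notMem_convexHull_of_subset hc (by grind))
    (notMem_convexHull_of_subset hd (by grind))
  have hw : det b c d ≠ 0 := det_ne_zero_of_notMem (d := a)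
    (notMem_convexHull_of_subset hb (by grind)) (notMem_convexHull_of_subset hc (by grind))
    (notMem_convexHull_of_subset hd (by grind))
  have hs := det_sum a b c d
  have hr := det_relation a b c d
  generalize det a b c = x at *
  generalize det a b d = y at *
  generalize det a c d = z at *
  generalize det b c d = w at *
  -- Signs in `w a - z b + y c - x d = 0`, whose coefficients sum to zero: one sign against three
  -- puts a point in the triangle of the others, `{a, b}` against `{c, d}` makes the segments meet,
  -- and four equal signs are impossible. What remains is `x y > 0` and `z w > 0`.
  rcases hx.lt_or_gt with hx | hx <;> rcases hy.lt_or_gt with hy | hy <;>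
    rcases hz.lt_or_gt with hz | hz <;> rcases hw.lt_or_gt with hw | hw
  · exact ⟨mul_pos_of_neg_of_neg hx hy, mul_pos_of_neg_of_neg hz hw⟩
  · exact absurd (mem_triangle_of_relation (α := w) (β := -z) (γ := -x)
      (δ := y) (by linarith) (by linarith) (by linarith) (by linarith) (by linarith)
      (by linear_combination (norm := module) (1 : ℝ) • hr)) hc
  · exact absurd (mem_triangle_of_relation (α := -w) (β := z) (γ := -y)
      (δ := x) (by linarith) (by linarith) (by linarith) (by linarith) (by linarith)
      (by linear_combination (norm := module) (-1 : ℝ) • hr)) hd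
  · exact ⟨mul_pos_of_neg_of_neg hx hy, mul_pos hz hw⟩
  · exact absurd (mem_triangle_of_relation (α := -z) (β := y) (γ := -x)
      (δ := w) (by linarith) (by linarith) (by linarith) (by linarith) (by linarith)
      (by linear_combination (norm := module) (1 : ℝ) • hr)) ha
  · linarith
  · exact absurd hdis (segments_meet_of_relation (α := -w) (β := z) (γ := -y)
      (δ := x) (by linarith) (by linarith) (by linarith) (by linarith) (by linarith)
      (by linear_combination (norm := module) (-1 : ℝ) • hr))
  · exact absurd (mem_triangle_of_relation (α := w) (β := y) (γ := -x)
      (δ := -z) (by linarith) (by linarith) (by linarith) (by linarith) (by linarith)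
      (by linear_combination (norm := module) (1 : ℝ) • hr)) hb
  · exact absurd (mem_triangle_of_relation (α := -w) (β := -y) (γ := x)
      (δ := z) (by linarith) (by linarith) (by linarith) (by linarith) (by linarith)
      (by linear_combination (norm := module) (-1 : ℝ) • hr)) hb
  · exact absurd hdis (segments_meet_of_relation (α := w) (β := -z) (γ := y)
      (δ := -x) (by linarith) (by linarith) (by linarith) (by linarith) (by linarith)
      (by linear_combination (norm := module) (1 : ℝ) • hr))
  · linarith
  · exact absurd (mem_triangle_of_relation (α := z) (β := -y) (γ := x)
      (δ := -w) (by linarith) (by linarith) (by linarith) (by linarith) (by linarith)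
      (by linear_combination (norm := module) (-1 : ℝ) • hr)) ha
  · exact ⟨mul_pos hx hy, mul_pos_of_neg_of_neg hz hw⟩
  · exact absurd (mem_triangle_of_relation (α := w) (β := -z) (γ := y)
      (δ := -x) (by linarith) (by linarith) (by linarith) (by linarith) (by linarith)
      (by linear_combination (norm := module) (1 : ℝ) • hr)) hd
  · exact absurd (mem_triangle_of_relation (α := -w) (β := z) (γ := x)
      (δ := -y) (by linarith) (by linarith) (by linarith) (by linarith) (by linarith)
      (by linear_combination (norm := module) (-1 : ℝ) • hr)) hc
  · exact ⟨mul_pos hx hy, mul_pos hz hw⟩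

/-- The points form, in this order, a strictly convex pentagon of orientation `s`. -/
def StrictlyConvex (s : ℝ) (p : Fin 5 → Plane) : Prop :=
  ∀ i j k, i < j → j < k → 0 < s * det (p i) (p j) (p k)

theorem strictlyConvex_iff {s : ℝ} {p : Fin 5 → Plane} : StrictlyConvex s p ↔
    0 < s * det (p 0) (p 1) (p 2) ∧ 0 < s * det (p 0) (p 1) (p 3) ∧
    0 < s * det (p 0) (p 1) (p 4) ∧ 0 < s * det (p 0) (p 2) (p 3) ∧
    0 < s * det (p 0) (p 2) (p 4) ∧ 0 < s * det (p 0) (p 3) (p 4) ∧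
    0 < s * det (p 1) (p 2) (p 3) ∧ 0 < s * det (p 1) (p 2) (p 4) ∧
    0 < s * det (p 1) (p 3) (p 4) ∧ 0 < s * det (p 2) (p 3) (p 4) := by
  constructor
  · intro h
    refine ⟨?_, ?_, ?_, ?_, ?_, ?_, ?_, ?_, ?_, ?_⟩ <;> exact h _ _ _ (by decide) (by decide)
  · rintro ⟨h0, h1, h2, h3, h4, h5, h6, h7, h8, h9⟩ i j k hij hjk
    fin_cases i <;> fin_cases j <;> first | exact absurd hij (by decide) | skip
    all_goals fin_cases k <;> first | exact absurd hjk (by decide) | assumption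

/-- A pentagon in convex position whose non-adjacent edges are disjoint is strictly convex. -/
theorem exists_strictlyConvex {p : Fin 5 → Plane}
    (hull : ∀ k, p k ∉ convexHull ℝ {p (k + 1), p (k + 2), p (k + 3), p (k + 4)})
    (hdis : ∀ k, Disjoint (segment ℝ (p k) (p (k + 1))) (segment ℝ (p (k + 2)) (p (k + 3)))) :
    ∃ s : ℝ, (s = 1 ∨ s = -1) ∧ StrictlyConvex s p := by
  -- Each of the five consecutive quadruples yields two equalities of orientation.
  have key : ∀ k, _ := fun k => orientations_of_four
    (a := p k) (b := p (k + 1)) (c := p (k + 2)) (d := p (k + 3))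
    (notMem_convexHull_of_subset (hull k) (by clear hull hdis; grind))
    (notMem_convexHull_of_subset (hull (k + 1)) (by
      have h1 : k + 1 + 1 = k + 2 := by grind
      have h2 : k + 1 + 2 = k + 3 := by grind
      have h4 : k + 1 + 4 = k := by grind
      rw [h1, h2, h4]; clear hull hdis; grind))
    (notMem_convexHull_of_subset (hull (k + 2)) (by
      have h1 : k + 2 + 1 = k + 3 := by grind
      have h3 : k + 2 + 3 = k := by grind
      have h4 : k + 2 + 4 = k + 1 := by grind
      rw [h1, h3, h4]; clear hull hdis; grind))
    (notMem_convexHull_of_subset (hull (k + 3)) (by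
      have h2 : k + 3 + 2 = k := by grind
      have h3 : k + 3 + 3 = k + 1 := by grind
      have h4 : k + 3 + 4 = k + 2 := by grind
      rw [h2, h3, h4]; clear hull hdis; grind)) (hdis k)
  have k0 := key 0
  have k1 := key 1
  have k2 := key 2
  have k3 := key 3
  have k4 := key 4
  clear key hull hdis
  simp only [Fin.isValue, zero_add, show (1 : Fin 5) + 1 = 2 from rfl,
    show (1 : Fin 5) + 2 = 3 from rfl, show (1 : Fin 5) + 3 = 4 from rfl,
    show (2 : Fin 5) + 1 = 3 from rfl, show (2 : Fin 5) + 2 = 4 from rfl,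
    show (2 : Fin 5) + 3 = 0 from rfl, show (3 : Fin 5) + 1 = 4 from rfl,
    show (3 : Fin 5) + 2 = 0 from rfl, show (3 : Fin 5) + 3 = 1 from rfl,
    show (4 : Fin 5) + 1 = 0 from rfl, show (4 : Fin 5) + 2 = 1 from rfl,
    show (4 : Fin 5) + 3 = 2 from rfl] at k0 k1 k2 k3 k4
  -- Cyclic rotations bring every determinant to increasing indices, so that the five quadruples
  -- speak of the same ten numbers.
  rw [det_rotate (p 0) (p 2) (p 3), det_rotate (p 0) (p 2) (p 4),
    det_rotate (p 0) (p 3) (p 4)] at k2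
  rw [det_rotate (p 0) (p 3) (p 4), det_rotate (p 1) (p 3) (p 4),
    ← det_rotate (p 3) (p 0) (p 1), ← det_rotate (p 4) (p 0) (p 1)] at k3
  rw [← det_rotate (p 4) (p 0) (p 1), ← det_rotate (p 4) (p 0) (p 2),
    ← det_rotate (p 4) (p 1) (p 2)] at k4
  simp only [strictlyConvex_iff]
  generalize det (p 0) (p 1) (p 2) = d012 at *
  generalize det (p 0) (p 1) (p 3) = d013 at *
  generalize det (p 0) (p 1) (p 4) = d014 at *
  generalize det (p 0) (p 2) (p 3) = d023 at *
  generalize det (p 0) (p 2) (p 4) = d024 at *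
  generalize det (p 0) (p 3) (p 4) = d034 at *
  generalize det (p 1) (p 2) (p 3) = d123 at *
  generalize det (p 1) (p 2) (p 4) = d124 at *
  generalize det (p 1) (p 3) (p 4) = d134 at *
  generalize det (p 2) (p 3) (p 4) = d234 at *
  clear p
  -- A chain of nine of the relations carries the sign of `d012` to all other determinants.
  rcases lt_or_gt_of_ne (left_ne_zero_of_mul k0.1.ne') with h012 | h012
  · have h013 := (neg_iff_neg_of_mul_pos k0.1).1 h012
    have h014 := (neg_iff_neg_of_mul_pos k3.2).1 h013
    have h024 := (neg_iff_neg_of_mul_pos k4.1).1 h014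
    have h034 := (neg_iff_neg_of_mul_pos k2.2).1 h024
    have h134 := (neg_iff_neg_of_mul_pos k3.1).1 h034
    have h234 := (neg_iff_neg_of_mul_pos k1.2).1 h134
    have h023 := (neg_iff_neg_of_mul_pos k2.1).1 h234
    have h123 := (neg_iff_neg_of_mul_pos k0.2).1 h023
    have h124 := (neg_iff_neg_of_mul_pos k1.1).1 h123
    refine ⟨-1, by simp, ?_⟩
    simp only [neg_mul, one_mul, neg_pos]
    exact ⟨h012, h013, h014, h023, h024, h034, h123, h124, h134, h234⟩
  · have h013 := (pos_iff_pos_of_mul_pos k0.1).1 h012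
    have h014 := (pos_iff_pos_of_mul_pos k3.2).1 h013
    have h024 := (pos_iff_pos_of_mul_pos k4.1).1 h014
    have h034 := (pos_iff_pos_of_mul_pos k2.2).1 h024
    have h134 := (pos_iff_pos_of_mul_pos k3.1).1 h034
    have h234 := (pos_iff_pos_of_mul_pos k1.2).1 h134
    have h023 := (pos_iff_pos_of_mul_pos k2.1).1 h234
    have h123 := (pos_iff_pos_of_mul_pos k0.2).1 h023
    have h124 := (pos_iff_pos_of_mul_pos k1.1).1 h123
    refine ⟨1, by simp, ?_⟩
    simp only [one_mul]
    exact ⟨h012, h013, h014, h023, h024, h034, h123, h124, h134, h234⟩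

/-! ### Efficient pentagons are strictly convex -/

theorem boundary_subset_convexHull {n : ℕ} (p : Polygon Plane n) :
    p.boundary ℝ ⊆ convexHull ℝ (range p.vertices) := by
  refine iUnion_subset fun i => ?_
  rw [Polygon.edgeSet, affineSegment_eq_segment]
  exact segment_subset_convexHull (mem_range_self i) (mem_range_self _)

theorem enclosedRegion_subset_convexHull {n : ℕ} [NeZero n] (p : Polygon Plane n) :
    p.enclosedRegion ⊆ convexHull ℝ (range p.vertices) := by
  rintro x ⟨hx, hb⟩
  by_contra hxK
  let c := p 0
  have hc : c ∈ convexHull ℝ (range p.vertices) := subset_convexHull ℝ _ (mem_range_self 0)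
  -- The ray from `x` pointing away from a vertex `c`. If it met the hull, `x` would lie between a
  -- point of the hull and `c`. So it avoids the boundary, and the component of `x` is unbounded.
  let g : ℝ → Plane := fun t => x + t • (x - c)
  have hg : ∀ t ∈ Ici (0 : ℝ), g t ∉ convexHull ℝ (range p.vertices) := by
    intro t ht hgt
    have ht' : 0 < 1 + t := by have : 0 ≤ t := ht; linarith
    apply hxK
    have hm := convex_convexHull ℝ (range p.vertices) hgt hc (a := 1 / (1 + t)) (b := t / (1 + t))
      (by positivity) (div_nonneg ht ht'.le) (by field_simp)
    have he : (1 / (1 + t)) • g t + (t / (1 + t)) • c = x := by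
      have h1 : x = (1 / (1 + t)) • ((1 + t) • x) := by
        rw [smul_smul, one_div, inv_mul_cancel₀ ht'.ne', one_smul]
      have h2 : (1 / (1 + t)) • g t + (t / (1 + t)) • c = (1 / (1 + t)) • ((1 + t) • x) := by
        have h3 : (t / (1 + t)) • c = (1 / (1 + t)) • (t • c) := by
          rw [smul_smul]; congr 1; ring
        rw [h3, ← smul_add]; congr 1; simp only [g]; module
      rw [h2, ← h1]
    rwa [he] at hm
  have hpc : IsPreconnected (g '' Ici 0) :=
    isPreconnected_Ici.image g (by fun_prop)
  have hsub : g '' Ici 0 ⊆ connectedComponentIn (p.boundary ℝ)ᶜ x := by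
    apply hpc.subset_connectedComponentIn
    · exact ⟨0, self_mem_Ici, by simp [g]⟩
    · rintro _ ⟨t, ht, rfl⟩ h
      exact hg t ht (boundary_subset_convexHull p h)
  obtain ⟨R, hR⟩ := (Metric.isBounded_iff_subset_closedBall x).1 (hb.subset hsub)
  have hxc : 0 < ‖x - c‖ := norm_pos_iff.2 (sub_ne_zero.2 fun h => hxK (h ▸ hc))
  have h1 := hR ⟨(|R| + 1) / ‖x - c‖, by simp only [mem_Ici]; positivity, rfl⟩
  simp only [g, Metric.mem_closedBall, dist_self_add_left, norm_smul, Real.norm_eq_abs] at h1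
  rw [abs_of_pos (by positivity), div_mul_cancel₀ _ hxc.ne'] at h1
  have := le_abs_self R
  linarith

theorem perimeter_eq (p : Polygon Plane 5) (k : Fin 5) :
    p.perimeter = dist (p k) (p (k + 1)) + dist (p (k + 1)) (p (k + 2)) +
      dist (p (k + 2)) (p (k + 3)) + dist (p (k + 3)) (p (k + 4)) + dist (p (k + 4)) (p k) := by
  simp only [Polygon.perimeter, finRotate_apply, Fin.sum_univ_five]
  fin_cases k <;> simp <;> ring

theorem perimeter_lt_four {p : Polygon Plane 5} (hp : p.IsEfficient) : p.perimeter < 4 := by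
  refine hp.perimeter_le.trans_lt ?_
  have h3 : √3 < 2 := by rw [Real.sqrt_lt' (by norm_num)]; norm_num
  have : √(2 + √3) < 2 := by rw [Real.sqrt_lt' (by norm_num)]; linarith
  linarith

theorem one_le_volume_convexHull {p : Polygon Plane 5} (hp : p.IsEfficient) :
    1 ≤ volume (convexHull ℝ (range p.vertices)) := by
  rw [← hp.area_eq_one]
  exact measure_mono (enclosedRegion_subset_convexHull p)

theorem range_eq (f : Fin 5 → Plane) (k : Fin 5) :
    range f = {f k, f (k + 1), f (k + 2), f (k + 3), f (k + 4)} := by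
  have : ∀ j k : Fin 5, j = k ∨ j = k + 1 ∨ j = k + 2 ∨ j = k + 3 ∨ j = k + 4 := by decide
  apply Subset.antisymm
  · rintro _ ⟨j, rfl⟩
    rcases this j k with h | h | h | h | h <;> simp [h]
  · intro x hx
    simp only [mem_insert_iff, mem_singleton_iff] at hx
    rcases hx with h | h | h | h | h <;> exact h ▸ mem_range_self _

/-- Dropping the vertex would not change the hull, and by the triangle inequality would not lengthen
the tour; four points with a tour shorter than 4 span area less than 1. -/
theorem notMem_convexHull_of_isEfficient {p : Polygon Plane 5} (hp : p.IsEfficient) (k : Fin 5) :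
    p k ∉ convexHull ℝ {p (k + 1), p (k + 2), p (k + 3), p (k + 4)} := by
  intro hk
  have h1 := one_le_volume_convexHull hp
  have hsub : convexHull ℝ (range p.vertices) ⊆
      convexHull ℝ {p (k + 1), p (k + 2), p (k + 3), p (k + 4)} := by
    rw [range_eq _ k]
    refine convexHull_min (insert_subset hk (subset_convexHull ℝ _)) (convex_convexHull ℝ _)
  have h2 := (h1.trans (measure_mono hsub)).trans (volume_convexHull_four_le _ _ _ _)
  rw [ENNReal.one_le_ofReal] at h2
  have h3 := perimeter_lt_four hp
  rw [perimeter_eq p k] at h3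
  have h4 := dist_triangle (p (k + 4)) (p k) (p (k + 1))
  have h5 : 0 ≤ dist (p (k + 1)) (p (k + 2)) + dist (p (k + 2)) (p (k + 3)) +
      dist (p (k + 3)) (p (k + 4)) + dist (p (k + 4)) (p (k + 1)) := by positivity
  nlinarith

theorem disjoint_segments {p : Polygon Plane 5} (hp : p.IsEfficient) (k : Fin 5) :
    Disjoint (segment ℝ (p k) (p (k + 1))) (segment ℝ (p (k + 2)) (p (k + 3))) := by
  have h := hp.isSimple.2.2 k (k + 2)
  simp only [finRotate_apply, Polygon.edgeSet, affineSegment_eq_segment] at h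
  have h3 : k + 2 + 1 = k + 3 := by rw [add_assoc]; rfl
  rw [h3] at h
  refine h ?_ ?_ ?_ <;> clear h h3 <;> revert k <;> decide

theorem exists_strictlyConvex_of_isEfficient {p : Polygon Plane 5} (hp : p.IsEfficient) :
    ∃ s : ℝ, (s = 1 ∨ s = -1) ∧ StrictlyConvex s p.vertices :=
  exists_strictlyConvex (notMem_convexHull_of_isEfficient hp) (disjoint_segments hp)

/-! ### Area, enclosed region and interior angles of a strictly convex pentagon -/

theorem StrictlyConvex.edge_pos {s : ℝ} {p : Fin 5 → Plane} (h : StrictlyConvex s p)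
    (i k : Fin 5) (hki : k ≠ i) (hki' : k ≠ i + 1) : 0 < s * det (p i) (p (i + 1)) (p k) := by
  have key : ∀ i k : Fin 5, k ≠ i → k ≠ i + 1 →
      (i < i + 1 ∧ i + 1 < k) ∨ (k < i ∧ i < i + 1) ∨ (i + 1 < k ∧ k < i) := by decide
  rcases key i k hki hki' with ⟨h1, h2⟩ | ⟨h1, h2⟩ | ⟨h1, h2⟩
  · exact h _ _ _ h1 h2
  · rw [det_rotate (p k)]; exact h _ _ _ h1 h2
  · rw [← det_rotate]; exact h _ _ _ h1 h2

theorem StrictlyConvex.edge_nonneg {s : ℝ} {p : Fin 5 → Plane} (h : StrictlyConvex s p)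
    (i k : Fin 5) : 0 ≤ s * det (p i) (p (i + 1)) (p k) := by
  by_cases hki : k = i
  · subst hki; simp [det_eq]
  by_cases hki' : k = i + 1
  · subst hki'; simp [det_eq]; ring_nf; simp
  exact (h.edge_pos i k hki hki').le

theorem det_combo (a b x y : Plane) {α β : ℝ} (h : α + β = 1) :
    det a b (α • x + β • y) = α * det a b x + β * det a b y := by
  obtain rfl : β = 1 - α := by linarith
  simp only [det_eq, PiLp.add_apply, PiLp.smul_apply, smul_eq_mul]; ring

theorem convex_halfPlane (s : ℝ) (a b : Plane) : Convex ℝ {x | 0 ≤ s * det a b x} := by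
  intro x hx y hy α β hα hβ h
  simp only [mem_ofPred_eq] at hx hy ⊢
  rw [det_combo _ _ _ _ h]
  have := mul_nonneg hα hx
  have := mul_nonneg hβ hy
  linarith

theorem continuous_det (a b : Plane) : Continuous (det a b) := by
  have : det a b = fun x => (b 0 - a 0) * (x 1 - a 1) - (b 1 - a 1) * (x 0 - a 0) := by
    ext x; exact det_eq a b x
  rw [this]; fun_prop

theorem mem_triangle_of_det {s : ℝ} {a b c x : Plane} (habc : 0 < s * det a b c)
    (h1 : 0 ≤ s * det a b x) (h2 : 0 ≤ s * det b c x) (h3 : s * det a c x ≤ 0) :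
    x ∈ convexHull ℝ {a, b, c} := by
  refine mem_triangle_of_relation (α := s * det b c x) (β := -(s * det a c x))
    (γ := s * det a b x) (δ := -(s * det a b c)) h2 (by linarith) h1 (by linarith) ?_ ?_
  · linear_combination s * det_sum a b c x
  · linear_combination (norm := module) s • det_relation a b c x

/-- The fan from `p 0`: the sides of `x` with respect to the diagonals to `p 2` and `p 3` decide
which triangle contains it. -/
theorem StrictlyConvex.mem_triangle {s : ℝ} {p : Fin 5 → Plane} (h : StrictlyConvex s p)
    {x : Plane} (hx : ∀ i, 0 ≤ s * det (p i) (p (i + 1)) x) :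
    x ∈ convexHull ℝ {p 0, p 1, p 2} ∪ convexHull ℝ {p 0, p 2, p 3} ∪
      convexHull ℝ {p 0, p 3, p 4} := by
  have h4 : s * det (p 0) (p 4) x ≤ 0 := by
    have := hx 4
    have e : det (p 4) (p (4 + 1)) x = -det (p 0) (p 4) x := by
      rw [show (4 : Fin 5) + 1 = 0 from rfl]
      simp only [det_eq]; ring
    rw [e] at this; linarith
  rcases le_total (s * det (p 0) (p 2) x) 0 with h2 | h2
  · exact Or.inl (Or.inl (mem_triangle_of_det (h _ _ _ (by decide) (by decide)) (hx 0) (hx 1) h2))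
  rcases le_total (s * det (p 0) (p 3) x) 0 with h3 | h3
  · exact Or.inl (Or.inr (mem_triangle_of_det (h _ _ _ (by decide) (by decide)) h2 (hx 2) h3))
  · exact Or.inr (mem_triangle_of_det (h _ _ _ (by decide) (by decide)) h3 (hx 3) h4)

theorem StrictlyConvex.volume_le {s : ℝ} (hs : s = 1 ∨ s = -1) {p : Fin 5 → Plane}
    (h : StrictlyConvex s p) : volume (convexHull ℝ (range p)) ≤ ENNReal.ofReal
      (s * (det (p 0) (p 1) (p 2) + det (p 0) (p 2) (p 3) + det (p 0) (p 3) (p 4)) / 2) := by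
  have habs : ∀ {d : ℝ}, 0 < s * d → |d| = s * d := by
    intro d hd
    rcases hs with rfl | rfl
    · rw [abs_of_pos (by linarith)]; ring
    · rw [abs_of_neg (by linarith)]; ring
  have hsub : convexHull ℝ (range p) ⊆ convexHull ℝ {p 0, p 1, p 2} ∪
      convexHull ℝ {p 0, p 2, p 3} ∪ convexHull ℝ {p 0, p 3, p 4} := by
    intro x hx
    refine h.mem_triangle fun i => ?_
    exact convexHull_min (t := {x | 0 ≤ s * det (p i) (p (i + 1)) x})
      (range_subset_iff.2 fun k => h.edge_nonneg i k) (convex_halfPlane _ _ _) hx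
  have h1 : 0 < s * det (p 0) (p 1) (p 2) := h _ _ _ (by decide) (by decide)
  have h2 : 0 < s * det (p 0) (p 2) (p 3) := h _ _ _ (by decide) (by decide)
  have h3 : 0 < s * det (p 0) (p 3) (p 4) := h _ _ _ (by decide) (by decide)
  refine (measure_mono hsub).trans ((measure_union_le _ _).trans ?_)
  refine (add_le_add (measure_union_le _ _) le_rfl).trans ?_
  refine (add_le_add (add_le_add (volume_triangle_le _ _ _) (volume_triangle_le _ _ _))
    (volume_triangle_le _ _ _)).trans ?_
  rw [habs h1, habs h2, habs h3, ← ENNReal.ofReal_add (by linarith) (by linarith),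
    ← ENNReal.ofReal_add (by linarith) (by linarith)]
  exact le_of_eq (by ring_nf)

/-- Points on the supporting line of an edge that lie in the closed pentagon are on the edge. -/
theorem mem_segment_of_det {s : ℝ} {a b c d x : Plane} (hab : a ≠ b)
    (habc : 0 < s * det b c a) (hdab : 0 < s * det d a b) (h0 : det a b x = 0)
    (h1 : 0 ≤ s * det b c x) (h2 : 0 ≤ s * det d a x) : x ∈ segment ℝ a b := by
  have hcol := collinear_of_det_eq_zero h0
  rw [collinear_iff_of_mem (p₀ := a) (by simp)] at hcol
  obtain ⟨v, hv⟩ := hcol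
  obtain ⟨rb, hb⟩ := hv b (by simp)
  obtain ⟨rx, hx⟩ := hv x (by simp)
  have hrb : rb ≠ 0 := by rintro rfl; simp at hb; exact hab hb.symm
  have hx' : x = (1 - rx / rb) • a + (rx / rb) • b := by
    rw [hx, hb]; simp only [vadd_eq_add, smul_add, smul_smul, div_mul_cancel₀ _ hrb]; module
  generalize rx / rb = t at hx'
  subst hx'
  rw [det_combo _ _ _ _ (by ring)] at h1 h2
  have e1 : det b c b = 0 := by simp [det_eq]
  have e2 : det d a a = 0 := by simp only [det_eq]; ring
  rw [e1] at h1
  rw [e2] at h2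
  -- On the line `ab` each neighbouring half-plane condition is linear in `t` and vanishes at an
  -- endpoint, so the two confine `t` to `[0, 1]`.
  have h1' : 0 ≤ (1 - t) * (s * det b c a) := by linarith
  have h2' : 0 ≤ t * (s * det d a b) := by linarith
  exact ⟨1 - t, t, nonneg_of_mul_nonneg_left h1' habc, nonneg_of_mul_nonneg_left h2' hdab,
    by ring, rfl⟩

/-- The frontier of the open intersection of half-planes lies on the boundary curve, so a component
of the complement meeting this bounded set cannot leave it. This inclusion settles the case
distinction in `interiorAngle`. -/
theorem StrictlyConvex.subset_enclosedRegion {s : ℝ} {p : Polygon Plane 5}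
    (h : StrictlyConvex s p.vertices) :
    {x | ∀ i, 0 < s * det (p i) (p (i + 1)) x} ⊆ p.enclosedRegion := by
  set U := {x | ∀ i, 0 < s * det (p i) (p (i + 1)) x} with hU
  have hUo : IsOpen U := by
    simp only [hU, ofPred_forall]
    exact isOpen_iInter_of_finite fun i =>
      isOpen_lt continuous_const (continuous_const.mul (continuous_det _ _))
  have hKc : IsClosed {x | ∀ i, 0 ≤ s * det (p i) (p (i + 1)) x} := by
    simp only [ofPred_forall]
    exact isClosed_iInter fun i =>
      isClosed_le continuous_const (continuous_const.mul (continuous_det _ _))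
  have hcl : closure U ⊆ {x | ∀ i, 0 ≤ s * det (p i) (p (i + 1)) x} :=
    closure_minimal (fun x hx i => (hx i).le) hKc
  have hfr : frontier U ⊆ p.boundary ℝ := by
    intro x hx
    rw [hUo.frontier_eq] at hx
    have hxK := hcl hx.1
    have : ∃ i, s * det (p i) (p (i + 1)) x = 0 := by
      by_contra! hne
      exact hx.2 fun i => lt_of_le_of_ne (hxK i) (hne i).symm
    obtain ⟨i, hi⟩ := this
    have hs : s ≠ 0 := by
      rintro rfl
      have := h 0 1 2 (by decide) (by decide)
      simp at this
    have e1 : i + 4 + 1 = i := by rw [add_assoc]; exact add_zero i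
    refine mem_iUnion.2 ⟨i, ?_⟩
    rw [Polygon.edgeSet, affineSegment_eq_segment, finRotate_apply]
    refine mem_segment_of_det (s := s) (c := p (i + 1 + 1)) (d := p (i + 4)) ?_ ?_ ?_
      ((mul_eq_zero_iff_left hs).1 hi) (hxK (i + 1)) ?_
    · intro he
      have := h.edge_pos i (i + 2) (by clear hi e1 he; revert i; decide)
        (by clear hi e1 he; revert i; decide)
      rw [he] at this
      simp [det_eq] at this
    · exact h.edge_pos (i + 1) i (by clear hi e1; revert i; decide) (by clear hi e1; revert i; decide)
    · have := h.edge_pos (i + 4) (i + 1) (by clear hi e1; revert i; decide)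
        (by clear hi e1; revert i; decide)
      rwa [e1] at this
    · have := hxK (i + 4)
      rwa [e1] at this
  have hdis : U ⊆ (p.boundary ℝ)ᶜ := by
    intro x hx hxb
    obtain ⟨i, hi⟩ := mem_iUnion.1 hxb
    rw [Polygon.edgeSet, affineSegment_eq_segment, finRotate_apply] at hi
    obtain ⟨α, β, hα, hβ, hαβ, rfl⟩ := hi
    have := hx i
    rw [det_combo _ _ _ _ hαβ] at this
    have e1 : det (p i) (p (i + 1)) (p i) = 0 := by simp [det_eq]
    have e2 : det (p i) (p (i + 1)) (p (i + 1)) = 0 := by simp only [det_eq]; ring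
    rw [e1, e2] at this
    simp at this
  intro x hx
  have hcomp : connectedComponentIn (p.boundary ℝ)ᶜ x ⊆ U := by
    refine isPreconnected_connectedComponentIn.subset_of_closure_inter_subset hUo
      ⟨x, mem_connectedComponentIn (hdis hx), hx⟩ ?_
    rintro y ⟨hy, hy'⟩
    by_contra hyU
    exact connectedComponentIn_subset _ _ hy' (hfr (by rw [hUo.frontier_eq]; exact ⟨hy, hyU⟩))
  refine ⟨hdis hx, Bornology.IsBounded.subset ?_ hcomp⟩
  have hK : U ⊆ convexHull ℝ (range p.vertices) := by
    intro y hy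
    rcases h.mem_triangle fun i => (hy i).le with (h | h) | h <;>
      refine convexHull_mono ?_ h <;>
      simp [insert_subset_iff]
  exact ((finite_range _).isCompact_convexHull (𝕜 := ℝ)).isBounded.subset hK

theorem StrictlyConvex.interiorAngle_eq {s : ℝ} {p : Polygon Plane 5}
    (h : StrictlyConvex s p.vertices) (i : Fin 5) :
    p.interiorAngle i = EuclideanGeometry.angle (p (i + 4)) (p i) (p (i + 1)) := by
  have hr : (finRotate 5).symm i = i + 4 := by
    rw [Equiv.symm_apply_eq, finRotate_apply]; revert i; decide
  rw [Polygon.interiorAngle, hr, finRotate_apply, if_pos]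
  have hev : ∀ᶠ t : ℝ in 𝓝[>] 0, t ∈ Ioo (0 : ℝ) 1 := Ioo_mem_nhdsGT zero_lt_one
  filter_upwards [hev] with t ht
  apply h.subset_enclosedRegion
  intro j
  have e : (AffineMap.lineMap (p i) (midpoint ℝ (p (i + 4)) (p (i + 1))) t : Plane) =
      (1 - t) • p i + t • ((1 / 2 : ℝ) • p (i + 4) + (1 / 2 : ℝ) • p (i + 1)) := by
    rw [AffineMap.lineMap_apply_module, midpoint_eq_smul_add]; simp
  rw [e, det_combo _ _ _ _ (by ring), det_combo _ _ _ _ (by norm_num)]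
  have h0 := h.edge_nonneg j i
  have h1 := h.edge_nonneg j (i + 4)
  have h2 := h.edge_nonneg j (i + 1)
  have ht0 := ht.1
  have ht1 : 0 < 1 - t := by linarith [ht.2]
  -- No edge contains all three of a vertex and its neighbours, so one of the three nonnegative
  -- terms is strictly positive.
  have key : ∀ i j : Fin 5, (i ≠ j ∧ i ≠ j + 1) ∨ (i + 4 ≠ j ∧ i + 4 ≠ j + 1) ∨
      (i + 1 ≠ j ∧ i + 1 ≠ j + 1) := by decide
  rcases key i j with hk | hk | hk
  all_goals
    have h3 := h.edge_pos j _ hk.1 hk.2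
    have := mul_pos ht1 h3
    have := mul_pos ht0 h3
    have := mul_nonneg ht0.le h1
    have := mul_nonneg ht0.le h2
    have := mul_nonneg ht1.le h0
    linarith

/-! ### Estimates for the tangent and the arctangent -/

theorem sub_le_arctan {x : ℝ} (hx : 0 ≤ x) : x - x ^ 3 / 3 ≤ Real.arctan x := by
  have hd : ∀ y : ℝ, HasDerivAt (fun y => Real.arctan y - (y - y ^ 3 / 3))
      (1 / (1 + y ^ 2) - (1 - (3 * y ^ 2) / 3)) y := fun y => by
    have h3 : HasDerivAt (fun y : ℝ => y ^ 3) (3 * y ^ 2) y := by simpa using hasDerivAt_pow 3 y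
    exact (Real.hasDerivAt_arctan y).sub ((hasDerivAt_id y).sub (h3.div_const 3))
  have hm : Monotone fun y : ℝ => Real.arctan y - (y - y ^ 3 / 3) := by
    refine monotone_of_deriv_nonneg (fun y => (hd y).differentiableAt) fun y => ?_
    rw [(hd y).deriv]
    have : 1 / (1 + y ^ 2) - (1 - (3 * y ^ 2) / 3) = y ^ 4 / (1 + y ^ 2) := by
      field_simp; ring
    rw [this]; positivity
  have := hm hx
  simp at this
  linarith

theorem arctan_le_add {x : ℝ} (hx : 0 ≤ x) : Real.arctan x ≤ x - x ^ 3 / 3 + x ^ 5 / 5 := by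
  have hd : ∀ y : ℝ, HasDerivAt (fun y => y - y ^ 3 / 3 + y ^ 5 / 5 - Real.arctan y)
      (1 - (3 * y ^ 2) / 3 + (5 * y ^ 4) / 5 - 1 / (1 + y ^ 2)) y := fun y => by
    have h3 : HasDerivAt (fun y : ℝ => y ^ 3) (3 * y ^ 2) y := by simpa using hasDerivAt_pow 3 y
    have h5 : HasDerivAt (fun y : ℝ => y ^ 5) (5 * y ^ 4) y := by simpa using hasDerivAt_pow 5 y
    exact (((hasDerivAt_id y).sub (h3.div_const 3)).add (h5.div_const 5)).sub
      (Real.hasDerivAt_arctan y)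
  have hm : Monotone fun y : ℝ => y - y ^ 3 / 3 + y ^ 5 / 5 - Real.arctan y := by
    refine monotone_of_deriv_nonneg (fun y => (hd y).differentiableAt) fun y => ?_
    rw [(hd y).deriv]
    have : 1 - (3 * y ^ 2) / 3 + (5 * y ^ 4) / 5 - 1 / (1 + y ^ 2) = y ^ 6 / (1 + y ^ 2) := by
      field_simp; ring
    rw [this]; positivity
  have := hm hx
  simp at this
  linarith

/-- The graph of the tangent function lies above its tangent lines. -/
theorem tangent_line_le_tan {R x : ℝ} (hR : 0 ≤ R) (hx0 : 0 ≤ x) (hx : x < π / 2) :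
    R + (1 + R ^ 2) * (x - Real.arctan R) ≤ Real.tan x := by
  -- On `y ≥ 0` this function is smallest at `R`; the claim compares its values at `R` and at `tan
  -- x`.
  let φ : ℝ → ℝ := fun y => y - (1 + R ^ 2) * Real.arctan y
  have hd : ∀ y : ℝ, HasDerivAt φ (1 - (1 + R ^ 2) * (1 / (1 + y ^ 2))) y := fun y =>
    (hasDerivAt_id y).sub ((Real.hasDerivAt_arctan y).const_mul _)
  have hc : Continuous φ := continuous_iff_continuousAt.2 fun y => (hd y).continuousAt
  have he : ∀ y : ℝ, 1 - (1 + R ^ 2) * (1 / (1 + y ^ 2)) = (y ^ 2 - R ^ 2) / (1 + y ^ 2) := by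
    intro y; field_simp; ring
  have hmono : MonotoneOn φ (Set.Ici R) := by
    refine monotoneOn_of_deriv_nonneg (convex_Ici R) hc.continuousOn
      (fun y _ => (hd y).differentiableAt.differentiableWithinAt) fun y hy => ?_
    rw [interior_Ici, Set.mem_Ioi] at hy
    rw [(hd y).deriv, he]
    exact div_nonneg (by nlinarith) (by positivity)
  have hanti : AntitoneOn φ (Set.Icc 0 R) := by
    refine antitoneOn_of_deriv_nonpos (convex_Icc 0 R) hc.continuousOn
      (fun y _ => (hd y).differentiableAt.differentiableWithinAt) fun y hy => ?_
    rw [interior_Icc, Set.mem_Ioo] at hy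
    rw [(hd y).deriv, he]
    exact div_nonpos_of_nonpos_of_nonneg (by nlinarith) (by positivity)
  have hy : 0 ≤ Real.tan x := Real.tan_nonneg_of_nonneg_of_le_pi_div_two hx0 hx.le
  have key : φ R ≤ φ (Real.tan x) := by
    rcases le_total R (Real.tan x) with h | h
    · exact hmono Set.self_mem_Ici h h
    · exact hanti ⟨hy, h⟩ ⟨hR, le_rfl⟩ h
  simp only [φ] at key
  rw [Real.arctan_tan (by linarith) hx] at key
  linarith

/-- Five half exterior angles, one of which is constrained: Jensen's inequality for the tangent. -/
theorem le_sum_tan {b : Fin 5 → ℝ} (h0 : ∀ i, 0 < b i) (h1 : ∀ i, b i < π / 2)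
    (hs : ∑ i, b i = π) (i : Fin 5) {R Q : ℝ} (hR : 0 ≤ R) (hQ : 0 ≤ Q)
    (hRQ : Real.arctan R + 4 * Real.arctan Q = π)
    (h : 0 ≤ (b i - Real.arctan R) * (R ^ 2 - Q ^ 2)) :
    R + 4 * Q ≤ ∑ i, Real.tan (b i) := by
  have hi := tangent_line_le_tan hR (h0 i).le (h1 i)
  have hj : ∑ j ∈ Finset.univ.erase i, (Q + (1 + Q ^ 2) * (b j - Real.arctan Q)) ≤
      ∑ j ∈ Finset.univ.erase i, Real.tan (b j) :=
    Finset.sum_le_sum fun j _ => tangent_line_le_tan hQ (h0 j).le (h1 j)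
  rw [Finset.sum_add_distrib, ← Finset.mul_sum, Finset.sum_sub_distrib, Finset.sum_const,
    Finset.sum_const, Finset.card_erase_of_mem (Finset.mem_univ i), Finset.card_univ,
    Fintype.card_fin] at hj
  rw [← Finset.sum_erase_add _ _ (Finset.mem_univ i)] at hs ⊢
  have e : ∑ j ∈ Finset.univ.erase i, b j = π - b i := by linarith
  rw [e] at hj
  simp only [Nat.reduceSub, nsmul_eq_mul, Nat.cast_ofNat] at hj
  -- Both angle sums equal `π`, so the linear terms collapse to `(R ^ 2 - Q ^ 2) * (b i - arctan
  -- R)`, nonnegative by `h`.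
  nlinarith

/-- The tangents of `4 arctan t` and of a quarter of its supplement. -/
theorem arctan_add_four_mul_arctan {t : ℝ} (h0 : 0 < t) (h1 : t ^ 2 + 2 * t < 1) :
    4 * Real.arctan t = Real.arctan (4 * t * (1 - t ^ 2) / (1 - 6 * t ^ 2 + t ^ 4)) ∧
    Real.arctan (4 * t * (1 - t ^ 2) / (1 - 6 * t ^ 2 + t ^ 4)) +
      4 * Real.arctan ((1 - t) / (1 + t)) = π := by
  -- For positive `t`, `h1` means `t < √2 - 1 = tan (π / 8)`; hence the doubling formula applies
  -- twice.
  have ht : t < 1 := by nlinarith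
  have hd : 0 < 1 - t ^ 2 := by nlinarith
  have e1 : 4 * Real.arctan t =
      Real.arctan (4 * t * (1 - t ^ 2) / (1 - 6 * t ^ 2 + t ^ 4)) := by
    have h2 : 2 * t / (1 - t ^ 2) < 1 := by rw [div_lt_one hd]; linarith
    have h3 : -1 < 2 * t / (1 - t ^ 2) := by
      have : 0 < 2 * t / (1 - t ^ 2) := by positivity
      linarith
    have h4 : 4 * Real.arctan t = 2 * (2 * Real.arctan t) := by ring
    rw [h4, Real.two_mul_arctan (by linarith) ht, Real.two_mul_arctan h3 h2]
    congr 1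
    have h5 : 1 - (2 * t / (1 - t ^ 2)) ^ 2 = (1 - 6 * t ^ 2 + t ^ 4) / (1 - t ^ 2) ^ 2 := by
      field_simp; ring
    rw [h5]
    have h6 : 1 - 6 * t ^ 2 + t ^ 4 ≠ 0 := by nlinarith
    field_simp
    ring
  refine ⟨e1, ?_⟩
  rw [← e1]
  have e2 : Real.arctan t + Real.arctan ((1 - t) / (1 + t)) = π / 4 := by
    rw [Real.arctan_add, ← Real.arctan_one]
    · congr 1
      have h2 : t + (1 - t) / (1 + t) = (1 + t ^ 2) / (1 + t) := by field_simp; ring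
      have h3 : 1 - t * ((1 - t) / (1 + t)) = (1 + t ^ 2) / (1 + t) := by field_simp; ring
      rw [h2, h3, div_self (by positivity)]
    · rw [mul_div_assoc', div_lt_one (by linarith)]; nlinarith
  linarith

/-- A half exterior angle is `(180° - a) / 2`, which sends 142.29° and 80.91° to 18.855° and
49.545°. -/
theorem half_exterior_bounds {b : Fin 5 → ℝ} (h0 : ∀ i, 0 < b i) (h1 : ∀ i, b i < π / 2)
    (hs : ∑ i, b i = π) (ht : ∑ i, Real.tan (b i) ≤ 2 + √3) (i : Fin 5) :
    18.855 * (π / 180) < b i ∧ b i < 49.545 * (π / 180) := by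
  have h3 : √3 < 1.7320509 := by rw [Real.sqrt_lt' (by norm_num)]; norm_num
  have hpi := Real.pi_lt_d6
  have hpi' := Real.pi_gt_d6
  constructor
  · by_contra! hb
    -- `4 arctan t` is just above 18.855°, while `R + 4 Q` still exceeds `2 + √3`. Taking the
    -- tangent of a quarter of the angle as parameter makes both `R` and `Q` rational.
    obtain ⟨e1, e2⟩ := arctan_add_four_mul_arctan (t := 0.08246) (by norm_num) (by norm_num)
    have h := le_sum_tan h0 h1 hs i (by norm_num) (by norm_num) e2 ?_
    · norm_num at h
      norm_num at h3
      linarith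
    · rw [← e1]
      have := sub_le_arctan (x := 0.08246) (by norm_num)
      apply mul_nonneg_of_nonpos_of_nonpos
      · norm_num at this hb hpi ⊢
        linarith
      · norm_num
  · by_contra! hb
    -- Here `4 arctan t` is just below 49.545°.
    obtain ⟨e1, e2⟩ := arctan_add_four_mul_arctan (t := 0.2196) (by norm_num) (by norm_num)
    have h := le_sum_tan h0 h1 hs i (by norm_num) (by norm_num) e2 ?_
    · norm_num at h
      norm_num at h3
      linarith
    · rw [← e1]
      have := arctan_le_add (x := 0.2196) (by norm_num)
      apply mul_nonneg
      · norm_num at this hb hpi' ⊢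
        linarith
      · norm_num

/-! ### Lhuilier's inequality in coordinates -/

/-- Contribution of a vertex `(X, Y)` between edges of unit directions `(c, d)`, `(c', d')`. -/
theorem vertex_identity {c d c' d' X Y r : ℝ} (e : c ^ 2 + d ^ 2 = 1) (e' : c' ^ 2 + d' ^ 2 = 1)
    (hS : 0 < c * d' - d * c') :
    (X * d - Y * c) * (X * c + Y * d) - (X * d' - Y * c') * (X * c' + Y * d') -
      2 * r * ((X * c + Y * d) - (X * c' + Y * d')) +
      2 * r ^ 2 * ((1 - (c * c' + d * d')) / (c * d' - d * c')) =
    (2 * (X * d - Y * c - r) * (X * d' - Y * c' - r) - (c * c' + d * d') *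
      ((X * d - Y * c - r) ^ 2 + (X * d' - Y * c' - r) ^ 2)) / (c * d' - d * c') := by
  have hV : (c * d' - d * c') * (X * c + Y * d) =
      (X * d' - Y * c') - (c * c' + d * d') * (X * d - Y * c) := by
    linear_combination (X * d' - Y * c') * e
  have hW : (c * d' - d * c') * (-(X * c' + Y * d')) =
      (X * d - Y * c) - (c * c' + d * d') * (X * d' - Y * c') := by
    linear_combination (X * d - Y * c) * e'
  rw [eq_div_iff hS.ne', add_mul, mul_assoc (2 * r ^ 2), div_mul_cancel₀ _ hS.ne']
  linear_combination (X * d - Y * c - 2 * r) * hV + (X * d' - Y * c' - 2 * r) * hW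

/-- With `α`, `β` the turns at the ends of the middle edge, the left side is `-(cot α + cot β) * g ^
2`, and `cot α + cot β = sin (α + β) / (sin α * sin β)`; `h` says `sin (α + β) ≥ 0`. -/
theorem cot_add_cot_mul_nonpos {c d c' d' c'' d'' : ℝ} (g : ℝ) (hS : 0 < c * d' - d * c')
    (hS' : 0 < c' * d'' - d' * c'') (e : c' ^ 2 + d' ^ 2 = 1) (h : 0 ≤ c * d'' - d * c'') :
    (2 * 0 * g - (c * c' + d * d') * (0 ^ 2 + g ^ 2)) / (c * d' - d * c') +
      (2 * g * 0 - (c' * c'' + d' * d'') * (g ^ 2 + 0 ^ 2)) / (c' * d'' - d' * c'') ≤ 0 := by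
  rw [div_add_div _ _ hS.ne' hS'.ne']
  apply div_nonpos_of_nonpos_of_nonneg _ (mul_pos hS hS').le
  have h1 : (2 * 0 * g - (c * c' + d * d') * (0 ^ 2 + g ^ 2)) * (c' * d'' - d' * c'') +
      (c * d' - d * c') * (2 * g * 0 - (c' * c'' + d' * d'') * (g ^ 2 + 0 ^ 2)) =
      -((c * d'' - d * c'') * g ^ 2) := by
    linear_combination -(c * d'' - d * c'') * g ^ 2 * e
  rw [h1]
  exact neg_nonpos.2 (mul_nonneg h (sq_nonneg g))

/-- Lhuilier's inequality for a pentagon whose edges `0`, `2`, `4` are at the same signed distance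
`r` from the origin. -/
theorem lhuilier_of_eq_dist {x y l c d : Fin 5 → ℝ} {r : ℝ}
    (hx : ∀ i, x (i + 1) = x i + l i * c i) (hy : ∀ i, y (i + 1) = y i + l i * d i)
    (hu : ∀ i, c i ^ 2 + d i ^ 2 = 1) (hS : ∀ i, 0 < c i * d (i + 1) - d i * c (i + 1))
    (h02 : 0 ≤ c 0 * d 2 - d 0 * c 2) (h24 : 0 ≤ c 2 * d 4 - d 2 * c 4)
    (h0 : x 0 * d 0 - y 0 * c 0 = r) (h4 : x 0 * d 4 - y 0 * c 4 = r)
    (h2 : x 2 * d 2 - y 2 * c 2 = r) :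
    ∑ i, (x i * y (i + 1) - y i * x (i + 1)) - 2 * r * ∑ i, l i + 2 * r ^ 2 *
      ∑ i, (1 - (c i * c (i + 1) + d i * d (i + 1))) / (c i * d (i + 1) - d i * c (i + 1)) ≤ 0 := by
  -- Summed over the vertices, `vertex_identity` writes the left side as a quadratic form in the
  -- deviations of the edge distances from `r`. Only edges `1` and `3` deviate, and they are not
  -- adjacent, so the form splits into two terms of one variable.
  have v := fun i => vertex_identity (X := x (i + 1)) (Y := y (i + 1)) (r := r) (hu i)
    (hu (i + 1)) (hS i)
  have hl : ∀ i, (x (i + 1) * c i + y (i + 1) * d i) - (x i * c i + y i * d i) = l i := by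
    intro i; rw [hx, hy]; linear_combination l i * hu i
  have hh : ∀ i, x (i + 1) * d i - y (i + 1) * c i = x i * d i - y i * c i := by
    intro i; rw [hx, hy]; ring
  have ha : ∀ i, x i * y (i + 1) - y i * x (i + 1) = (x i * d i - y i * c i) * l i := by
    intro i; rw [hx, hy]; ring
  have v0 := v 0
  have v1 := v 1
  have v2 := v 2
  have v3 := v 3
  have v4 := v 4
  have l0 := hl 0
  have l1 := hl 1
  have l2 := hl 2
  have l3 := hl 3
  have l4 := hl 4
  have k0 := hh 0
  have k1 := hh 1
  have k2 := hh 2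
  have k3 := hh 3
  have k4 := hh 4
  have S0 := hS 0
  have S1 := hS 1
  have S2 := hS 2
  have S3 := hS 3
  simp only [ha]
  simp only [Fin.sum_univ_five]
  simp only [Fin.isValue, zero_add, show (1 : Fin 5) + 1 = 2 from rfl,
    show (2 : Fin 5) + 1 = 3 from rfl, show (3 : Fin 5) + 1 = 4 from rfl,
    show (4 : Fin 5) + 1 = 0 from rfl] at *
  have h4' : x 4 * d 4 - y 4 * c 4 = r := by rw [← k4, h4]
  rw [k0, h0, sub_self] at v0
  rw [k1, h2, sub_self] at v1
  rw [k2, h2, sub_self] at v2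
  rw [k3, h4', sub_self] at v3
  rw [h4, h0, sub_self] at v4
  have p1 := cot_add_cot_mul_nonpos (x 1 * d 1 - y 1 * c 1 - r) S0 S1 (hu 1) h02
  have p2 := cot_add_cot_mul_nonpos (x 3 * d 3 - y 3 * c 3 - r) S2 S3 (hu 3) h24
  rw [h0, h2, h4', ← l0, ← l1, ← l2, ← l3, ← l4]
  refine le_of_eq_of_le ?_ (add_nonpos p1 p2)
  linear_combination v0 + v1 + v2 + v3 + v4

/-- Lhuilier's inequality for a pentagon, in coordinates. -/
theorem lhuilier_coordinates {x y l c d : Fin 5 → ℝ}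
    (hx : ∀ i, x (i + 1) = x i + l i * c i) (hy : ∀ i, y (i + 1) = y i + l i * d i)
    (hu : ∀ i, c i ^ 2 + d i ^ 2 = 1) (hS : ∀ i, 0 < c i * d (i + 1) - d i * c (i + 1))
    (h02 : 0 ≤ c 0 * d 2 - d 0 * c 2) (h24 : 0 ≤ c 2 * d 4 - d 2 * c 4) :
    2 * (∑ i, (x i * y (i + 1) - y i * x (i + 1))) *
      ∑ i, (1 - (c i * c (i + 1) + d i * d (i + 1))) / (c i * d (i + 1) - d i * c (i + 1)) ≤
      (∑ i, l i) ^ 2 := by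
  have hC : 0 ≤ ∑ i, (1 - (c i * c (i + 1) + d i * d (i + 1))) /
      (c i * d (i + 1) - d i * c (i + 1)) :=
    Finset.sum_nonneg fun i _ => div_nonneg (by
      nlinarith [hu i, hu (i + 1), sq_nonneg (c i - c (i + 1)), sq_nonneg (d i - d (i + 1))])
      (hS i).le
  set C := ∑ i, (1 - (c i * c (i + 1) + d i * d (i + 1))) / (c i * d (i + 1) - d i * c (i + 1))
    with hCdef
  have S4 : 0 < c 4 * d 0 - d 4 * c 0 := hS 4
  have hN : 0 < (c 0 * d 2 - d 0 * c 2) + (c 2 * d 4 - d 2 * c 4) + (c 4 * d 0 - d 4 * c 0) := by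
    linarith
  set N := (c 0 * d 2 - d 0 * c 2) + (c 2 * d 4 - d 2 * c 4) + (c 4 * d 0 - d 4 * c 0) with hNdef
  -- Moving vertex `0` to `m` times the difference of the directions of edges `0` and `4` puts these
  -- two edges at the same signed distance `r` from the origin. Requiring the same of edge `2` is
  -- then linear in `m`, with coefficient `N`.
  let m := -((x 2 - x 0) * d 2 - (y 2 - y 0) * c 2) / N
  have hm : m * N = -((x 2 - x 0) * d 2 - (y 2 - y 0) * c 2) := div_mul_cancel₀ _ hN.ne'
  let u := m * (c 0 - c 4) - x 0
  let v := m * (d 0 - d 4) - y 0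
  let r := -m * (c 4 * d 0 - d 4 * c 0)
  have key := lhuilier_of_eq_dist (x := fun i => x i + u) (y := fun i => y i + v) (l := l) (c := c)
    (d := d) (r := r) (fun i => by simp only [hx]; ring) (fun i => by simp only [hy]; ring) hu hS
    h02 h24 (by simp only [u, v, r]; ring) (by simp only [u, v, r]; ring)
    (by simp only [u, v, r]; linear_combination hm)
  have hA : ∑ i, ((x i + u) * (y (i + 1) + v) - (y i + v) * (x (i + 1) + u)) =
      ∑ i, (x i * y (i + 1) - y i * x (i + 1)) := by
    simp only [Fin.sum_univ_five]
    simp only [Fin.isValue, zero_add, show (1 : Fin 5) + 1 = 2 from rfl,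
      show (2 : Fin 5) + 1 = 3 from rfl, show (3 : Fin 5) + 1 = 4 from rfl,
      show (4 : Fin 5) + 1 = 0 from rfl]
    ring
  simp only [hA, ← hCdef] at key
  -- A quadratic `S - 2 r L + 2 r ^ 2 C` that is nonpositive for some `r` forces `2 S C ≤ L ^ 2`:
  -- multiply by `2 C` and complete the square `(L - 2 r C) ^ 2`.
  nlinarith [mul_nonneg hC (sub_nonneg.2 key), sq_nonneg (∑ i, l i - 2 * r * C)]

/-! ### Turning angles -/

open InnerProductGeometry in
theorem sin_angle_eq {s : ℝ} (hs : s = 1 ∨ s = -1) {v w : Plane} (h : 0 < s * cross v w) :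
    Real.sin (angle v w) * (‖v‖ * ‖w‖) = s * cross v w := by
  rw [sin_angle_mul_norm_mul_norm]
  have h1 : inner ℝ v v * inner ℝ w w - inner ℝ v w * inner ℝ v w = (s * cross v w) ^ 2 := by
    have hs2 : s ^ 2 = 1 := by rcases hs with rfl | rfl <;> norm_num
    rw [mul_pow, hs2]
    simp only [inner_eq, cross]; ring
  rw [h1, Real.sqrt_sq h.le]

theorem norm_pos_of_cross {s : ℝ} {v w : Plane} (h : 0 < s * cross v w) : 0 < ‖v‖ ∧ 0 < ‖w‖ := by
  constructor <;>
  · rw [norm_pos_iff]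
    rintro rfl
    simp [cross] at h

open InnerProductGeometry in
theorem sin_angle_pos {s : ℝ} (hs : s = 1 ∨ s = -1) {v w : Plane} (h : 0 < s * cross v w) :
    0 < Real.sin (angle v w) := by
  obtain ⟨hv, hw⟩ := norm_pos_of_cross h
  have := sin_angle_eq hs h
  rw [← this] at h
  exact pos_of_mul_pos_left h (by positivity)

open InnerProductGeometry in
theorem angle_mem_Ioo {s : ℝ} (hs : s = 1 ∨ s = -1) {v w : Plane} (h : 0 < s * cross v w) :
    0 < angle v w ∧ angle v w < π := by
  have h1 := sin_angle_pos hs h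
  constructor
  · refine lt_of_le_of_ne (angle_nonneg v w) fun h0 => ?_
    rw [← h0, Real.sin_zero] at h1; exact lt_irrefl _ h1
  · refine lt_of_le_of_ne (angle_le_pi v w) fun h0 => ?_
    rw [h0, Real.sin_pi] at h1; exact lt_irrefl _ h1

open InnerProductGeometry in
/-- Unoriented angles add up when the three vectors lie in this order in a half-plane. -/
theorem angle_add_of_cross_pos {s : ℝ} (hs : s = 1 ∨ s = -1) {u v w : Plane}
    (huv : 0 < s * cross u v) (hvw : 0 < s * cross v w) (huw : 0 < s * cross u w) :
    angle u w = angle u v + angle v w := by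
  obtain ⟨hu, hv⟩ := norm_pos_of_cross huv
  obtain ⟨-, hw⟩ := norm_pos_of_cross hvw
  have s1 := sin_angle_eq hs huv
  have s2 := sin_angle_eq hs hvw
  have s3 := sin_angle_eq hs huw
  have c1 := cos_angle_mul_norm_mul_norm u v
  have c2 := cos_angle_mul_norm_mul_norm v w
  have c3 := cos_angle_mul_norm_mul_norm u w
  have hs2 : s ^ 2 = 1 := by rcases hs with rfl | rfl <;> norm_num
  have nv := norm_sq_eq v
  rw [inner_eq] at c1 c2 c3
  simp only [cross] at s1 s2 s3
  have hpos : 0 < ‖u‖ * ‖w‖ * ‖v‖ ^ 2 := by positivity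
  have hsin : Real.sin (angle u v + angle v w) = Real.sin (angle u w) := by
    rw [Real.sin_add]
    apply mul_right_cancel₀ hpos.ne'
    linear_combination (Real.cos (angle v w) * (‖v‖ * ‖w‖)) * s1 +
      s * (u 0 * v 1 - u 1 * v 0) * c2 + (Real.sin (angle v w) * (‖v‖ * ‖w‖)) * c1 +
      (u 0 * v 0 + u 1 * v 1) * s2 - ‖v‖ ^ 2 * s3 - s * (u 0 * w 1 - u 1 * w 0) * nv
  have hcos : Real.cos (angle u v + angle v w) = Real.cos (angle u w) := by
    rw [Real.cos_add]
    apply mul_right_cancel₀ hpos.ne'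
    linear_combination (Real.cos (angle v w) * (‖v‖ * ‖w‖)) * c1 +
      (u 0 * v 0 + u 1 * v 1) * c2 - (Real.sin (angle v w) * (‖v‖ * ‖w‖)) * s1 -
      s * (u 0 * v 1 - u 1 * v 0) * s2 - ‖v‖ ^ 2 * c3 - (u 0 * w 0 + u 1 * w 1) * nv -
      (u 0 * v 1 - u 1 * v 0) * (v 0 * w 1 - v 1 * w 0) * hs2
  obtain ⟨a1, a2⟩ := angle_mem_Ioo hs huv
  obtain ⟨b1, b2⟩ := angle_mem_Ioo hs hvw
  obtain ⟨d1, d2⟩ := angle_mem_Ioo hs huw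
  -- Sine and cosine determine the sum only modulo `2 π`; its positive sine keeps it in `[0, π]`,
  -- where the cosine is injective.
  have hle : angle u v + angle v w ≤ π := by
    by_contra! hgt
    have h1 := sin_angle_pos hs huw
    rw [← hsin] at h1
    have h2 := Real.sin_neg_of_neg_of_neg_pi_lt (x := angle u v + angle v w - 2 * π)
      (by linarith) (by linarith)
    rw [Real.sin_sub_two_pi] at h2
    linarith
  exact Real.injOn_cos ⟨d1.le, d2.le⟩ ⟨by linarith, hle⟩ hcos.symm

/-- The turning angle of a pentagon from the edge `i` to the next one. -/
noncomputable def turn (p : Fin 5 → Plane) (i : Fin 5) : ℝ :=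
  InnerProductGeometry.angle (p (i + 1) - p i) (p (i + 1 + 1) - p (i + 1))

theorem turn_eq (p : Fin 5 → Plane) (i : Fin 5) :
    turn p i = π - EuclideanGeometry.angle (p i) (p (i + 1)) (p (i + 1 + 1)) := by
  rw [turn, EuclideanGeometry.angle, vsub_eq_sub, vsub_eq_sub, ← neg_sub (p (i + 1)) (p i),
    InnerProductGeometry.angle_neg_left]
  ring

theorem StrictlyConvex.cross_pos {s : ℝ} {p : Fin 5 → Plane} (h : StrictlyConvex s p)
    (i : Fin 5) : 0 < s * cross (p (i + 1) - p i) (p (i + 1 + 1) - p (i + 1)) := by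
  have := h.edge_pos i (i + 1 + 1) (by revert i; decide) (by revert i; decide)
  have e : cross (p (i + 1) - p i) (p (i + 1 + 1) - p (i + 1)) =
      det (p i) (p (i + 1)) (p (i + 1 + 1)) := by
    rw [det_eq]; simp only [cross, PiLp.sub_apply]; ring
  rwa [e]

theorem angle_add_of_det_pos {s : ℝ} (hs : s = 1 ∨ s = -1) {o x y z : Plane}
    (hxy : 0 < s * det o x y) (hyz : 0 < s * det o y z) (hxz : 0 < s * det o x z) :
    EuclideanGeometry.angle x o z = EuclideanGeometry.angle x o y + EuclideanGeometry.angle y o z :=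
  angle_add_of_cross_pos hs hxy hyz hxz

/-- The fan from `p 0` cuts the pentagon into three triangles, so the interior angles add up to `3
π`. -/
theorem sum_turn {s : ℝ} (hs : s = 1 ∨ s = -1) {p : Fin 5 → Plane} (h : StrictlyConvex s p) :
    ∑ i, turn p i = 2 * π := by
  obtain ⟨d012, d013, d014, d023, d024, d034, d123, d124, d134, d234⟩ := strictlyConvex_iff.1 h
  have hne : ∀ {a b c : Plane}, 0 < s * det a b c → b ≠ a := by
    rintro a b c h rfl
    simp [det_eq] at h
  simp only [turn_eq, Fin.sum_univ_five]
  simp only [Fin.isValue, zero_add, show (1 : Fin 5) + 1 = 2 from rfl,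
    show (2 : Fin 5) + 1 = 3 from rfl, show (3 : Fin 5) + 1 = 4 from rfl,
    show (4 : Fin 5) + 1 = 0 from rfl]
  have a0 := angle_add_of_det_pos hs d012 d024 d014
  have a0' := angle_add_of_det_pos hs d023 d034 d024
  have a2 := angle_add_of_det_pos hs (o := p 2) (x := p 3) (y := p 0) (z := p 1)
    (by rwa [det_rotate]) (by rwa [← det_rotate]) (by rwa [det_rotate])
  have a3 := angle_add_of_det_pos hs (o := p 3) (x := p 4) (y := p 0) (z := p 2)
    (by rwa [det_rotate]) (by rwa [← det_rotate]) (by rwa [det_rotate])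
  have t1 := EuclideanGeometry.angle_add_angle_add_angle_eq_pi (p 2) (hne d012)
  have t2 := EuclideanGeometry.angle_add_angle_add_angle_eq_pi (p 3) (hne d023)
  have t3 := EuclideanGeometry.angle_add_angle_add_angle_eq_pi (p 4) (hne d034)
  rw [EuclideanGeometry.angle_comm (p 4) (p 0) (p 1)]
  rw [EuclideanGeometry.angle_comm (p 3) (p 2) (p 1), EuclideanGeometry.angle_comm (p 3) (p 2) (p 0),
    EuclideanGeometry.angle_comm (p 0) (p 2) (p 1)] at a2
  rw [EuclideanGeometry.angle_comm (p 4) (p 3) (p 2), EuclideanGeometry.angle_comm (p 4) (p 3) (p 0),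
    EuclideanGeometry.angle_comm (p 0) (p 3) (p 2)] at a3
  rw [EuclideanGeometry.angle_comm (p 2) (p 0) (p 1)] at t1
  rw [EuclideanGeometry.angle_comm (p 3) (p 0) (p 2)] at t2
  rw [EuclideanGeometry.angle_comm (p 4) (p 0) (p 3)] at t3
  linarith

theorem tan_half_eq {x : ℝ} (h0 : 0 < x) (h1 : x < π) :
    Real.tan (x / 2) = (1 - Real.cos x) / Real.sin x := by
  have hc : 0 < Real.cos (x / 2) := Real.cos_pos_of_mem_Ioo ⟨by linarith, by linarith⟩
  have hs : 0 < Real.sin (x / 2) := Real.sin_pos_of_pos_of_lt_pi (by linarith) (by linarith)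
  have e1 : Real.sin x = 2 * Real.sin (x / 2) * Real.cos (x / 2) := by
    rw [← Real.sin_two_mul]; congr 1; ring
  have e2 : 1 - Real.cos x = 2 * Real.sin (x / 2) ^ 2 := by
    have : Real.cos x = 1 - 2 * Real.sin (x / 2) ^ 2 := by
      rw [← Real.cos_two_mul_eq_one_sub]; congr 1; ring
    linarith
  rw [e1, e2, Real.tan_eq_sin_div_cos]
  field_simp

/-! ### Lhuilier's inequality and the bound on the tangents -/

/-- Lhuilier's inequality for a pentagon of which two disjoint pairs of adjacent vertices turn by
at most `π` each. -/
theorem lhuilier {s : ℝ} (hs : s = 1 ∨ s = -1) {p : Fin 5 → Plane} (h : StrictlyConvex s p)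
    (h01 : turn p 0 + turn p 1 ≤ π) (h23 : turn p 2 + turn p 3 ≤ π) :
    2 * (s * (det (p 0) (p 1) (p 2) + det (p 0) (p 2) (p 3) + det (p 0) (p 3) (p 4))) *
      ∑ i, Real.tan (turn p i / 2) ≤ (∑ i, dist (p i) (p (i + 1))) ^ 2 := by
  have hs2 : s ^ 2 = 1 := by rcases hs with rfl | rfl <;> norm_num
  let l : Fin 5 → ℝ := fun i => ‖p (i + 1) - p i‖
  let c : Fin 5 → ℝ := fun i => (p (i + 1) 0 - p i 0) / l i
  -- The factor `s` reflects a clockwise pentagon into a counterclockwise one.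
  let d : Fin 5 → ℝ := fun i => s * (p (i + 1) 1 - p i 1) / l i
  have hl : ∀ i, 0 < l i := fun i => (norm_pos_of_cross (h.cross_pos i)).1
  have hK : ∀ i, c i * c (i + 1) + d i * d (i + 1) = Real.cos (turn p i) := by
    intro i
    have e := InnerProductGeometry.cos_angle_mul_norm_mul_norm (p (i + 1) - p i)
      (p (i + 1 + 1) - p (i + 1))
    change Real.cos (turn p i) * (l i * l (i + 1)) = _ at e
    have := hl i
    have := hl (i + 1)
    apply mul_right_cancel₀ (b := l i * l (i + 1)) (by positivity)
    rw [e, inner_eq]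
    simp only [c, d, PiLp.sub_apply]
    field_simp
    rw [hs2]; ring
  have hS : ∀ i, c i * d (i + 1) - d i * c (i + 1) = Real.sin (turn p i) := by
    intro i
    have e := sin_angle_eq hs (h.cross_pos i)
    change Real.sin (turn p i) * (l i * l (i + 1)) = _ at e
    have := hl i
    have := hl (i + 1)
    apply mul_right_cancel₀ (b := l i * l (i + 1)) (by positivity)
    rw [e]
    simp only [c, d, cross, PiLp.sub_apply]
    field_simp
  have hu : ∀ i, c i ^ 2 + d i ^ 2 = 1 := by
    intro i
    have := hl i
    have e : l i ^ 2 = (p (i + 1) 0 - p i 0) ^ 2 + (p (i + 1) 1 - p i 1) ^ 2 := norm_sq_eq _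
    simp only [c, d, div_pow, mul_pow, hs2]
    rw [← add_div, e, div_eq_one_iff_eq (by rw [← e]; positivity)]
    ring
  have hturn : ∀ i, 0 < turn p i ∧ turn p i < π := fun i => angle_mem_Ioo hs (h.cross_pos i)
  have hpair : ∀ i, turn p i + turn p (i + 1) ≤ π →
      0 ≤ c i * d (i + 1 + 1) - d i * c (i + 1 + 1) := by
    intro i hi
    have e : c i * d (i + 1 + 1) - d i * c (i + 1 + 1) =
        Real.sin (turn p i + turn p (i + 1)) := by
      rw [Real.sin_add, ← hK, ← hS, ← hK, ← hS]
      linear_combination -(c i * d (i + 1 + 1) - d i * c (i + 1 + 1)) * hu (i + 1)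
    rw [e]
    exact Real.sin_nonneg_of_nonneg_of_le_pi (by linarith [hturn i, hturn (i + 1)]) hi
  have key := lhuilier_coordinates (x := fun i => p i 0) (y := fun i => s * p i 1) (l := l)
    (c := c) (d := d) (fun i => by simp only [c]; have := hl i; field_simp; ring)
    (fun i => by simp only [d]; have := hl i; field_simp; ring) hu
    (fun i => by
      rw [hS]; exact Real.sin_pos_of_pos_of_lt_pi (hturn i).1 (hturn i).2) (hpair 0 h01)
    (hpair 2 h23)
  have hA : ∑ i, (p i 0 * (s * p (i + 1) 1) - s * p i 1 * p (i + 1) 0) =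
      s * (det (p 0) (p 1) (p 2) + det (p 0) (p 2) (p 3) + det (p 0) (p 3) (p 4)) := by
    simp only [Fin.sum_univ_five, det_eq]
    simp only [Fin.isValue, zero_add, show (1 : Fin 5) + 1 = 2 from rfl,
      show (2 : Fin 5) + 1 = 3 from rfl, show (3 : Fin 5) + 1 = 4 from rfl,
      show (4 : Fin 5) + 1 = 0 from rfl]
    ring
  have hT : ∀ i, Real.tan (turn p i / 2) = (1 - (c i * c (i + 1) + d i * d (i + 1))) /
      (c i * d (i + 1) - d i * c (i + 1)) := fun i => by
    rw [hK, hS, tan_half_eq (hturn i).1 (hturn i).2]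
  have hd : ∀ i, dist (p i) (p (i + 1)) = l i := fun i => by
    rw [dist_comm, dist_eq_norm]
  simp only [hT, hd]
  rw [hA] at key
  exact key

theorem StrictlyConvex.shift {s : ℝ} {p : Fin 5 → Plane} (h : StrictlyConvex s p) (k : Fin 5) :
    StrictlyConvex s fun i => p (i + k) := by
  have key : ∀ k i j l : Fin 5, i < j → j < l → (i + k < j + k ∧ j + k < l + k) ∨
      (j + k < l + k ∧ l + k < i + k) ∨ (l + k < i + k ∧ i + k < j + k) := by decide
  intro i j l hij hjl
  rcases key k i j l hij hjl with ⟨h1, h2⟩ | ⟨h1, h2⟩ | ⟨h1, h2⟩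
  · exact h _ _ _ h1 h2
  · rw [← det_rotate]; exact h _ _ _ h1 h2
  · rw [det_rotate (p (l + k))]; exact h _ _ _ h1 h2

/-- Two disjoint adjacent pairs cannot both exceed `π`, so at most two pairs do, and these share an
index. The other three pairs are consecutive, and the outer two of them are disjoint. -/
theorem exists_disjoint_pairs {τ : Fin 5 → ℝ} (h0 : ∀ i, 0 < τ i)
    (hs : ∑ i, τ i = 2 * π) :
    ∃ k, τ k + τ (k + 1) ≤ π ∧ τ (k + 2) + τ (k + 3) ≤ π := by
  by_contra! hc
  have c0 := hc 0
  have c1 := hc 1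
  have c2 := hc 2
  have c3 := hc 3
  have c4 := hc 4
  have := h0 0
  have := h0 1
  have := h0 2
  have := h0 3
  have := h0 4
  rw [Fin.sum_univ_five] at hs
  simp only [Fin.isValue, zero_add, show (1 : Fin 5) + 1 = 2 from rfl,
    show (1 : Fin 5) + 2 = 3 from rfl, show (1 : Fin 5) + 3 = 4 from rfl,
    show (2 : Fin 5) + 1 = 3 from rfl, show (2 : Fin 5) + 2 = 4 from rfl,
    show (2 : Fin 5) + 3 = 0 from rfl, show (3 : Fin 5) + 1 = 4 from rfl,
    show (3 : Fin 5) + 2 = 0 from rfl, show (3 : Fin 5) + 3 = 1 from rfl,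
    show (4 : Fin 5) + 1 = 0 from rfl, show (4 : Fin 5) + 2 = 1 from rfl,
    show (4 : Fin 5) + 3 = 2 from rfl] at c0 c1 c2 c3 c4
  rcases le_or_gt (τ 0 + τ 1) π with g0 | g0
  · have g2 := c0 g0
    rcases le_or_gt (τ 1 + τ 2) π with g1 | g1
    · have := c4 (by by_contra! g4; linarith)
      linarith
    · have := c3 (by linarith)
      linarith
  · have g2 : τ 2 + τ 3 ≤ π := by linarith
    have g4 := c2 g2
    have g1 : τ 1 + τ 2 ≤ π := by linarith
    have := c1 g1
    linarith

/-- Lhuilier's inequality after a cyclic relabelling that moves the two small pairs to `0, 1` and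
`2, 3`; the area it involves is at least that of the hull, hence at least 1. -/
theorem sum_tan_turn_le {p : Polygon Plane 5} (hp : p.IsEfficient) {s : ℝ} (hs : s = 1 ∨ s = -1)
    (h : StrictlyConvex s p.vertices) :
    ∑ i, Real.tan (turn p.vertices i / 2) ≤ 2 + √3 := by
  have hturn : ∀ i, 0 < turn p.vertices i ∧ turn p.vertices i < π :=
    fun i => angle_mem_Ioo hs (h.cross_pos i)
  obtain ⟨k, hk, hk'⟩ := exists_disjoint_pairs (fun i => (hturn i).1)
    (sum_turn hs h)
  have hq := h.shift k
  set q : Fin 5 → Plane := fun i => p (i + k) with hqdef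
  have ht : ∀ i, turn q i = turn p.vertices (i + k) := fun i => by
    simp only [turn, hqdef, add_right_comm _ 1 k]
  have key := lhuilier hs hq (by rw [ht, ht, zero_add, add_comm 1 k]; exact hk)
    (by rw [ht, ht, add_comm 2 k, add_comm 3 k]; exact hk')
  have hr : range q = range p.vertices :=
    (Equiv.addRight k).surjective.range_comp p.vertices
  have hvol := (one_le_volume_convexHull hp).trans (hr ▸ hq.volume_le hs)
  rw [ENNReal.one_le_ofReal] at hvol
  have hsum : ∑ i, Real.tan (turn q i / 2) = ∑ i, Real.tan (turn p.vertices i / 2) := by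
    simp only [ht]
    exact Equiv.sum_comp (Equiv.addRight k) fun i => Real.tan (turn p.vertices i / 2)
  have hper : ∑ i, dist (q i) (q (i + 1)) = p.perimeter := by
    simp only [hqdef, add_right_comm _ 1 k, Polygon.perimeter, finRotate_apply]
    exact Equiv.sum_comp (Equiv.addRight k) fun i => dist (p i) (p (i + 1))
  rw [hsum, hper] at key
  have hC : 0 ≤ ∑ i, Real.tan (turn p.vertices i / 2) := Finset.sum_nonneg fun i _ =>
    Real.tan_nonneg_of_nonneg_of_le_pi_div_two (by linarith [hturn i]) (by linarith [hturn i])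
  have hP0 : 0 ≤ p.perimeter := Finset.sum_nonneg fun i _ => dist_nonneg
  have hP : p.perimeter ^ 2 ≤ 4 * (2 + √3) := by
    calc p.perimeter ^ 2 ≤ (2 * √(2 + √3)) ^ 2 := pow_le_pow_left₀ hP0 hp.perimeter_le 2
      _ = 4 * (2 + √3) := by rw [mul_pow, Real.sq_sqrt (by positivity)]; norm_num
  nlinarith

end Pentagon

theorem proposition2p9 (p : Polygon (EuclideanSpace ℝ (Fin 2)) 5) (hp : p.IsEfficient)
    (i : Fin 5) :
    80.91 * (π / 180) < p.interiorAngle i ∧ p.interiorAngle i < 142.29 * (π / 180) := by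
  obtain ⟨s, hs, h⟩ := Pentagon.exists_strictlyConvex_of_isEfficient hp
  have hturn : ∀ i, 0 < Pentagon.turn p.vertices i ∧ Pentagon.turn p.vertices i < π :=
    fun i => Pentagon.angle_mem_Ioo hs (h.cross_pos i)
  -- `turn p i` is located at vertex `i + 1`, so vertex `i` has index `i + 4`.
  obtain ⟨h1, h2⟩ := Pentagon.half_exterior_bounds (b := fun i => Pentagon.turn p.vertices i / 2)
    (fun i => by linarith [hturn i]) (fun i => by linarith [hturn i])
    (by rw [← Finset.sum_div, Pentagon.sum_turn hs h]; ring)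
    (Pentagon.sum_tan_turn_le hp hs h) (i + 4)
  have e1 : i + 4 + 1 = i := by rw [add_assoc]; exact add_zero i
  rw [Pentagon.turn_eq, e1, ← h.interiorAngle_eq i] at h1 h2
  constructor <;> linarith
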